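/- A function $\varphi:\mathbb{R}\to[0,\infty)$ is called log-concave if $\varphi(sx+(1-s)y)\ge \varphi(x)^s\varphi(y)^{1-s}$ for all $x,y\in\mathbb{R}$ and $s\in(0,1)$. For $\lambda\in(0,1)$ put $\tau=\min(\lambda,1-\lambda)$. (Stability.) There is an absolute constant $C>0$ such that the following holds. Let $\lambda\in(0,1)$, $\varepsilon\ge 0$, and let $h,f,g:\mathbb{R}\to[0,\infty)$ be integrable functions with $\int f>0$, $\int g>0$ and $$h(\lambda x+(1-\lambda)y)\ge f(x)^{\lambda}g(y)^{1-\lambda}\qquad\text{for all }x,y\in\mathbb{R}.$$ Suppose that either $h$ is log-concave or both $f$ and $g$ are log-concave, and that $$\int_{\mathbb{R}} h\le(1+\varepsilon)\Big(\int_{\mathbb{R}} f\Big)^{\lambda}\Big(\int_{\mathbb{R}} g\Big)^{1-\lambda}.$$ Then there exist $a>0$, $x_0\in\mathbb{R}$ and an integrable log-concave function $\tilde h:\mathbb{R}\to[0,\infty)$ such that $$\int_{\mathbb{R}}\big|f(x)-a^{-(1-\lambda)}\tilde h(x+(1-\lambda)x_0)\big|\,dx\le C\Big(\frac{\varepsilon}{\tau}\Big)^{1/2}\int_{\mathbb{R}}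 f,$$ $$\int_{\mathbb{R}}\big|g(x)-a^{\lambda}\tilde h(x-\lambda x_0)\big|\,dx\le C\Big(\frac{\varepsilon}{\tau}\Big)^{1/2}\int_{\mathbb{R}} g,$$ $$\int_{\mathbb{R}}\big|h(x)-\tilde h(x)\big|\,dx\le C\Big(\frac{\varepsilon}{\tau}\Big)^{1/2}\int_{\mathbb{R}} h.$$ (Sharpness.) There are absolute constants $c\in(0,1)$ and $\varepsilon_0>0$ such that for every $\lambda\in(0,1)$ and every $0<\varepsilon\le\varepsilon_0\tau$ there exist log-concave probability densities $f,g$ on $\mathbb{R}$ for which the function $h(z)=\sup_{z=\lambda x+(1-\lambda)y}f(x)^{\lambda}g(y)^{1-\lambda}$ is finite and integrable with $\int_{\mathbb{R}} h<1+\varepsilon$, while $$\int_{\mathbb{R}}|g(x)-f(x+x_0)|\,dx\ge c\Big(\frac{\varepsilon}{\tau}\Big)^{1/2}\qquad\text{for every }x_0\in\mathbb{R},$$ and such that for all $a>0$, $x_0\in\mathbb{R}$ and all integrable log-concave $\tilde h$ at least one of the first two inequalities above is reversed with $c$ in place of $C$, that is, $$\int_{\mathbb{R}}\big|f(x)-a^{-(1-\lambda)}\tilde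 h(x+(1-\lambda)x_0)\big|\,dx\ge c\Big(\frac{\varepsilon}{\tau}\Big)^{1/2}\int_{\mathbb{R}} f\quad\text{or}\quad\int_{\mathbb{R}}\big|g(x)-a^{\lambda}\tilde h(x-\lambda x_0)\big|\,dx\ge c\Big(\frac{\varepsilon}{\tau}\Big)^{1/2}\int_{\mathbb{R}} g.$$ -/

import Mathlib

open MeasureTheory

/-- A function `φ : ℝ → ℝ₊` is log-concave if
`φ (s x + (1 - s) y) ≥ φ(x)^s φ(y)^(1-s)` for all `x, y` and all `s ∈ (0,1)`. -/
def LogConcave (φ : ℝ → ℝ) : Prop :=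
  (∀ x, 0 ≤ φ x) ∧
    ∀ x y s : ℝ, 0 < s → s < 1 → φ x ^ s * φ y ^ (1 - s) ≤ φ (s * x + (1 - s) * y)

/-- The Prékopa–Leindler condition with parameter `lam` for `h, f, g`:
`h (lam x + (1 - lam) y) ≥ f(x)^lam g(y)^(1-lam)` for all `x, y`. -/
def PLCondition (lam : ℝ) (h f g : ℝ → ℝ) : Prop :=
  ∀ x y : ℝ, f x ^ lam * g y ^ (1 - lam) ≤ h (lam * x + (1 - lam) * y)

/-- The function `z ↦ sup { f(x)^lam g(y)^(1-lam) : z = lam x + (1 - lam) y }`. -/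
noncomputable def supConv (lam : ℝ) (f g : ℝ → ℝ) (z : ℝ) : ℝ :=
  sSup {r : ℝ | ∃ x y : ℝ, z = lam * x + (1 - lam) * y ∧ r = f x ^ lam * g y ^ (1 - lam)}

/-! ### Sharpness: two uniform densities on intervals of slightly different length. -/

section Sharpness

open Set

/-! Stability. Normalize `f` and `g` to mass 1 and write `μ = 1 - λ`, `τ = min λ μ`. Transport, but
parametrize by `z`: monotone maps `x`, `y` with `λ x + μ y = z` and equal distribution functions `F
(x z) = G (y z)` (`exists_monotone_coupling`). Both are Lipschitz, so change of variables needs no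
positivity of `f` or `g`. With `a = x'` and `b = y'`, one has `λ a + μ b = 1`, and `ρ = a f(x) = b
g(y)` has mass 1. Hence `h ≥ f(x)^λ g(y)^μ = ρ a^(-λ) b^(-μ) ≥ ρ (1 + λ (a - 1 - log a))`: the
deficit `∫ h - 1` controls how far `a` is from 1.

To turn this into an L¹ bound, let `k` be the translate of `h` for which `x` matches the mode of `h`
with that of `k`. Then `a (f(x) - k(x)) ≤ ρ (1 - a) + a (h - k(x))`. The last term is handled by
layer cake: `h` is unimodal, so its superlevel sets are intervals about the mode, and the mass that
`x` carries out of such an interval `I` is at most `∫_I (a - 1)₊` (`lintegral_displacement_le`).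
What remains, `ρ (1 - a)₊ + h (a - 1)₊`, costs at most `η ρ + C / (η λ) (h - ρ)` for `η ≤ 1`; taking
`η = √(ε/τ)` balances the two. Log-concavity of `h` serves only to give a measurable unimodal
function. If instead `f` and `g` are log-concave, their sup-convolution replaces `h`; if `ε ≥ τ`,
zero is a good enough approximant.

Sharpness. For uniform densities on `[0, 1]` and `[0, e^u]` with `u = √(ε/τ)`, the deficit is of
second order in `u` while the L¹ distance, up to translation, is of first order. -/

theorem logConcave_indicator_Icc {c : ℝ} (hc : 0 ≤ c) (a b : ℝ) :
    LogConcave ((Icc a b).indicator fun _ => c) := by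
  refine ⟨fun x => indicator_nonneg (fun _ _ => hc) x, fun x y s hs hs1 => ?_⟩
  have hs' : 0 < 1 - s := by linarith
  by_cases hx : x ∈ Icc a b
  · by_cases hy : y ∈ Icc a b
    · rw [indicator_of_mem hx, indicator_of_mem hy, indicator_of_mem]
      · rcases hc.eq_or_lt with rfl | hc
        · simp [Real.zero_rpow hs.ne']
        · rw [← Real.rpow_add hc]; simp
      · exact convex_Icc a b hx hy hs.le hs'.le (by ring)
    · rw [indicator_of_notMem hy, Real.zero_rpow hs'.ne', mul_zero]
      exact indicator_nonneg (fun _ _ => hc) _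
  · rw [indicator_of_notMem hx, Real.zero_rpow hs.ne', zero_mul]
    exact indicator_nonneg (fun _ _ => hc) _

theorem integrable_indicator_Icc (a b c : ℝ) : Integrable ((Icc a b).indicator fun _ : ℝ => c) :=
  (integrable_indicator_iff measurableSet_Icc).2 (integrableOn_const (by simp))

theorem integral_indicator_Icc {a b : ℝ} (hab : a ≤ b) (c : ℝ) :
    ∫ x, (Icc a b).indicator (fun _ => c) x = (b - a) * c := by
  rw [integral_indicator_const _ measurableSet_Icc]
  simp [Measure.real, hab]

theorem indicator_rpow_mul_indicator_rpow_le {lam b : ℝ} (hl : 0 < lam) (hl1 : lam < 1) (hb : 0 < b)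
    (x y : ℝ) :
    (Icc 0 1).indicator (fun _ => (1 : ℝ)) x ^ lam * (Icc 0 b).indicator (fun _ => b⁻¹) y ^ (1 - lam)
      ≤ (Icc 0 (lam + (1 - lam) * b)).indicator (fun _ => b ^ (-(1 - lam)))
        (lam * x + (1 - lam) * y) := by
  have hm : 0 < 1 - lam := by linarith
  have hnn : 0 ≤ (Icc 0 (lam + (1 - lam) * b)).indicator (fun _ => b ^ (-(1 - lam)))
      (lam * x + (1 - lam) * y) := indicator_nonneg (fun _ _ => by positivity) _
  by_cases hx : x ∈ Icc (0 : ℝ) 1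
  · by_cases hy : y ∈ Icc 0 b
    · rw [indicator_of_mem hx, indicator_of_mem hy, indicator_of_mem, Real.one_rpow, one_mul,
        Real.inv_rpow hb.le, Real.rpow_neg hb.le]
      have h1 := mul_le_mul_of_nonneg_left hx.2 hl.le
      have h2 := mul_le_mul_of_nonneg_left hy.2 hm.le
      exact ⟨add_nonneg (mul_nonneg hl.le hx.1) (mul_nonneg hm.le hy.1), by linarith⟩
    · rwa [indicator_of_notMem hy, Real.zero_rpow hm.ne', mul_zero]
  · rwa [indicator_of_notMem hx, Real.zero_rpow hl.ne', zero_mul]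

theorem supConv_indicator {lam b : ℝ} (hl : 0 < lam) (hl1 : lam < 1) (hb : 0 < b) :
    supConv lam ((Icc 0 1).indicator fun _ => 1) ((Icc 0 b).indicator fun _ => b⁻¹)
      = (Icc 0 (lam + (1 - lam) * b)).indicator fun _ => b ^ (-(1 - lam)) := by
  have hm : 0 < 1 - lam := by linarith
  ext z
  have hub : ∀ r ∈ {r : ℝ | ∃ x y : ℝ, z = lam * x + (1 - lam) * y ∧
      r = (Icc 0 1).indicator (fun _ => (1 : ℝ)) x ^ lam *
        (Icc 0 b).indicator (fun _ => b⁻¹) y ^ (1 - lam)},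
      r ≤ (Icc 0 (lam + (1 - lam) * b)).indicator (fun _ => b ^ (-(1 - lam))) z := by
    rintro r ⟨x, y, rfl, rfl⟩
    exact indicator_rpow_mul_indicator_rpow_le hl hl1 hb x y
  refine IsGreatest.csSup_eq ⟨?_, hub⟩
  set L := lam + (1 - lam) * b with hL
  have hL0 : 0 < L := by positivity
  by_cases hz : z ∈ Icc 0 L
  · refine ⟨z / L, b * (z / L), ?_, ?_⟩
    · rw [hL]; field_simp
    · have h0 : 0 ≤ z / L := div_nonneg hz.1 hL0.le
      have h1 : z / L ≤ 1 := (div_le_one hL0).2 hz.2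
      rw [indicator_of_mem hz, indicator_of_mem (show z / L ∈ Icc (0 : ℝ) 1 from ⟨h0, h1⟩),
        indicator_of_mem (show b * (z / L) ∈ Icc 0 b from ⟨by positivity, by nlinarith⟩),
        Real.one_rpow, one_mul, Real.inv_rpow hb.le, Real.rpow_neg hb.le]
  · have he : z = lam * z + (1 - lam) * z := by ring
    refine ⟨z, z, he, le_antisymm ?_ (hub _ ⟨z, z, he, rfl⟩)⟩
    rw [indicator_of_notMem hz]
    exact mul_nonneg (Real.rpow_nonneg (indicator_nonneg (fun _ _ => zero_le_one) _) _)
      (Real.rpow_nonneg (indicator_nonneg (fun _ _ => by positivity) _) _)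

/-- By `e^v ≤ 1 + v + v²` the first-order terms in `u` cancel, leaving `λ(1-λ)u²`, which is strictly
below `τ u²`. -/
theorem exp_mix_lt {lam u : ℝ} (hl : 0 < lam) (hl1 : lam < 1) (hu0 : 0 < u) (hu1 : u ≤ 1) :
    (lam + (1 - lam) * Real.exp u) * Real.exp u ^ (-(1 - lam))
      < 1 + min lam (1 - lam) * u ^ 2 := by
  have hm : 0 < 1 - lam := by linarith
  have e : (lam + (1 - lam) * Real.exp u) * Real.exp u ^ (-(1 - lam))
      = lam * Real.exp (-(1 - lam) * u) + (1 - lam) * Real.exp (lam * u) := by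
    rw [← Real.exp_mul, add_mul, mul_assoc (1 - lam), ← Real.exp_add]
    congr 2
    · congr 1; ring
    · congr 1; ring
  have hexp : ∀ v : ℝ, |v| ≤ 1 → Real.exp v ≤ 1 + v + v ^ 2 := by
    intro v hv
    have := (abs_le.1 (Real.abs_exp_sub_one_sub_id_le hv)).2
    linarith
  have h1 := hexp (-(1 - lam) * u) (by rw [abs_le]; constructor <;> nlinarith)
  have h2 := hexp (lam * u) (by rw [abs_le]; constructor <;> nlinarith)
  have h3 : lam * (1 - lam) < min lam (1 - lam) := lt_min (by nlinarith) (by nlinarith)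
  rw [e]
  calc lam * Real.exp (-(1 - lam) * u) + (1 - lam) * Real.exp (lam * u)
      ≤ lam * (1 + -(1 - lam) * u + (-(1 - lam) * u) ^ 2)
        + (1 - lam) * (1 + lam * u + (lam * u) ^ 2) := by gcongr
    _ = 1 + lam * (1 - lam) * u ^ 2 := by ring
    _ < _ := by gcongr

theorem le_integral_abs_indicator_sub {u : ℝ} (hu0 : 0 < u) (hu1 : u ≤ 1) (x₀ : ℝ) :
    u ≤ ∫ x, |(Icc 0 (Real.exp u)).indicator (fun _ => (Real.exp u)⁻¹) x
      - (Icc 0 1).indicator (fun _ => (1 : ℝ)) (x + x₀)| := by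
  set b := Real.exp u with hb
  have hb1 : 1 ≤ b := Real.one_le_exp hu0.le
  have hb0 : 0 < b := by linarith
  set g := (Icc 0 b).indicator (fun _ => b⁻¹) with hg
  set f : ℝ → ℝ := fun x => (Icc 0 1).indicator (fun _ => (1 : ℝ)) (x + x₀) with hf
  set k : ℝ → ℝ := fun x => (Icc 0 1).indicator (fun _ => 1 - b⁻¹) (x + x₀) with hk
  have hfi : Integrable f := (integrable_indicator_Icc 0 1 1).comp_add_right x₀
  have hki : Integrable k := (integrable_indicator_Icc 0 1 (1 - b⁻¹)).comp_add_right x₀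
  have hgi : Integrable g := integrable_indicator_Icc 0 b b⁻¹
  have hf1 : ∫ x, f x = 1 := by
    rw [hf, integral_add_right_eq_self ((Icc (0 : ℝ) 1).indicator fun _ => (1 : ℝ)),
      integral_indicator_Icc zero_le_one]
    norm_num
  have hg1 : ∫ x, g x = 1 := by
    rw [hg, integral_indicator_Icc hb0.le, sub_zero, mul_inv_cancel₀ hb0.ne']
  have hk1 : ∫ x, k x = 1 - b⁻¹ := by
    rw [hk, integral_add_right_eq_self ((Icc (0 : ℝ) 1).indicator fun _ => 1 - b⁻¹),
      integral_indicator_Icc zero_le_one]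
    ring
  have hbi : b⁻¹ ≤ 1 := inv_le_one_of_one_le₀ hb1
  -- On the support of the translated `f`, `f - g ≥ 1 - 1/b`. As `f` and `g` have equal mass, the
  -- distance is at least twice the integral of this, and `1/b ≤ 1/(1+u) ≤ 1 - u/2`.
  have hpt : ∀ x, g x - f x + 2 * k x ≤ |g x - f x| := by
    intro x
    have hgx : g x ≤ b⁻¹ := indicator_le_self' (fun _ _ => by positivity) x
    by_cases hx : x + x₀ ∈ Icc (0 : ℝ) 1
    · have e1 : f x = 1 := indicator_of_mem hx _
      have e2 : k x = 1 - b⁻¹ := indicator_of_mem hx _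
      rw [e1, e2, abs_of_nonpos (by linarith)]
      linarith
    · have e2 : k x = 0 := indicator_of_notMem hx _
      rw [e2, mul_zero, add_zero]
      exact le_abs_self _
  have hgf : Integrable fun x => g x - f x := hgi.sub hfi
  have hint : ∫ x, (g x - f x + 2 * k x) ≤ ∫ x, |g x - f x| :=
    integral_mono (hgf.add (hki.const_mul 2)) hgf.abs hpt
  rw [integral_add hgf (hki.const_mul 2), integral_sub hgi hfi, integral_const_mul, hf1, hg1, hk1]
    at hint
  have hbu : b⁻¹ ≤ 1 - u / 2 := by
    rw [hb, ← Real.exp_neg]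
    have h2 : Real.exp (-u) * (1 + u) ≤ 1 := by
      have h3 := Real.add_one_le_exp u
      have : Real.exp (-u) * Real.exp u = 1 := by rw [← Real.exp_add]; simp
      nlinarith [Real.exp_pos (-u)]
    nlinarith
  linarith

/-- If `f` and `g` are both close to translates of multiples of `k`, they are close to translates
of each other. -/
theorem integral_abs_sub_translate_le {f g k : ℝ → ℝ} {lam a x₀ d : ℝ} (ha : 0 < a)
    (hd : d ≤ 1 / 2) (hf : Integrable f) (hg : Integrable g) (hk : Integrable k)
    (hf0 : ∀ x, 0 ≤ f x)
    (hf1 : ∫ x, f x = 1) (hg1 : ∫ x, g x = 1)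
    (h1 : ∫ x, |f x - a ^ (-(1 - lam)) * k (x + (1 - lam) * x₀)| ≤ d)
    (h2 : ∫ x, |g x - a ^ lam * k (x - lam * x₀)| ≤ d) :
    ∫ x, |g x - f (x + -x₀)| ≤ 8 * d := by
  set k₁ : ℝ → ℝ := fun x => k (x - lam * x₀) with hk₁
  have hk₁i : Integrable k₁ := by
    simpa [hk₁, sub_eq_add_neg] using hk.comp_add_right (-(lam * x₀))
  set F : ℝ → ℝ := fun x => f (x + -x₀) with hF
  have hFi : Integrable F := hf.comp_add_right _
  have hF1 : ∫ x, F x = 1 := (integral_add_right_eq_self f _).trans hf1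
  have h1' : ∫ x, |F x - a ^ (-(1 - lam)) * k₁ x| ≤ d := by
    rw [← integral_add_right_eq_self _ (-x₀)] at h1
    refine le_of_eq_of_le (integral_congr_ae (ae_of_all _ fun x => ?_)) h1
    simp only [hk₁, hF]
    rw [show x - lam * x₀ = x + -x₀ + (1 - lam) * x₀ by ring]
  have hpow : a ^ lam = a * a ^ (-(1 - lam)) := by
    rw [show lam = 1 + -(1 - lam) by ring, Real.rpow_add ha, Real.rpow_one]
    ring_nf
  have hA : Integrable fun x => |g x - a ^ lam * k₁ x| := (hg.sub (hk₁i.const_mul _)).abs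
  have hB : Integrable fun x => |F x - a ^ (-(1 - lam)) * k₁ x| :=
    (hFi.sub (hk₁i.const_mul _)).abs
  have hpt : ∀ x, |g x - a * F x| ≤ |g x - a ^ lam * k₁ x| + a * |F x - a ^ (-(1 - lam)) * k₁ x| := by
    intro x
    rw [← abs_of_pos ha, ← abs_mul, abs_of_pos ha, mul_sub, ← mul_assoc, ← hpow,
      abs_sub_comm (a * F x)]
    exact abs_sub_le _ _ _
  have hgF : Integrable fun x => g x - a * F x := hg.sub (hFi.const_mul a)
  have hint : ∫ x, |g x - a * F x| ≤ d + a * d := by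
    refine (integral_mono hgF.abs (hA.add (hB.const_mul a)) hpt).trans ?_
    rw [integral_add' hA (hB.const_mul a), integral_const_mul]
    exact add_le_add h2 (mul_le_mul_of_nonneg_left h1' ha.le)
  -- Equal masses force the scaling `a` to be near 1. With `d ≤ 1/2` this yields `a ≤ 3`, and the
  -- total `2(1 + a)d` is at most `8d`.
  have habs : |1 - a| ≤ d + a * d := by
    have : ∫ x, (g x - a * F x) = 1 - a := by
      rw [integral_sub hg (hFi.const_mul a), integral_const_mul, hg1, hF1, mul_one]
    rw [← this]
    exact abs_integral_le_integral_abs.trans hint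
  have hfin : ∫ x, |g x - F x| ≤ (∫ x, |g x - a * F x|) + |1 - a| * ∫ x, |F x| := by
    rw [← integral_const_mul, ← integral_add hgF.abs (hFi.abs.const_mul _)]
    refine integral_mono (hg.sub hFi).abs (hgF.abs.add (hFi.abs.const_mul _)) fun x => ?_
    simp only
    rw [← abs_mul, show g x - F x = (g x - a * F x) + -((1 - a) * F x) by ring, ← abs_neg ((1 - a) * F x)]
    exact abs_add_le _ _
  have hFabs : ∫ x, |F x| = 1 := by
    rw [← hF1]
    exact integral_congr_ae (ae_of_all _ fun x => abs_of_nonneg (hf0 _))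
  rw [hFabs, mul_one] at hfin
  have hd0 : 0 ≤ d := (integral_nonneg fun x => abs_nonneg _).trans h2
  have ha3 : a ≤ 3 := by
    have := (abs_le.1 habs).1
    nlinarith
  nlinarith

theorem exists_logConcave_far {lam ε : ℝ} (hl : 0 < lam) (hl1 : lam < 1) (hε : 0 < ε)
    (hε1 : ε ≤ 1 * min lam (1 - lam)) :
    ∃ h f g : ℝ → ℝ, LogConcave f ∧ LogConcave g ∧ Integrable h ∧ Integrable f ∧ Integrable g ∧
      ∫ x, f x = 1 ∧ ∫ x, g x = 1 ∧ h = supConv lam f g ∧ PLCondition lam h f g ∧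
      ∫ x, h x < 1 + ε ∧
      (∀ x₀ : ℝ, 1 / 16 * (ε / min lam (1 - lam)) ^ (1 / 2 : ℝ) ≤ ∫ x, |g x - f (x + x₀)|) ∧
      ∀ (a x₀ : ℝ) (k : ℝ → ℝ), 0 < a → LogConcave k → Integrable k →
        1 / 16 * (ε / min lam (1 - lam)) ^ (1 / 2 : ℝ) * ∫ x, f x
          ≤ ∫ x, |f x - a ^ (-(1 - lam)) * k (x + (1 - lam) * x₀)| ∨
        1 / 16 * (ε / min lam (1 - lam)) ^ (1 / 2 : ℝ) * ∫ x, g x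
          ≤ ∫ x, |g x - a ^ lam * k (x - lam * x₀)| := by
  have ht : 0 < min lam (1 - lam) := lt_min hl (by linarith)
  rw [← Real.sqrt_eq_rpow]
  set u := Real.sqrt (ε / min lam (1 - lam)) with hu
  have hu0 : 0 < u := Real.sqrt_pos.2 (by positivity)
  have hu1 : u ≤ 1 := Real.sqrt_le_one.2 ((div_le_one ht).2 (by linarith))
  have hu2 : min lam (1 - lam) * u ^ 2 = ε := by
    rw [hu, Real.sq_sqrt (by positivity)]; field_simp
  have hb : 0 < Real.exp u := Real.exp_pos u
  have hL : 0 ≤ lam + (1 - lam) * Real.exp u := by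
    have : 0 < 1 - lam := by linarith
    positivity
  have hf1 : ∫ x, (Icc (0 : ℝ) 1).indicator (fun _ => (1 : ℝ)) x = 1 := by
    rw [integral_indicator_Icc zero_le_one]; norm_num
  have hg1 : ∫ x, (Icc 0 (Real.exp u)).indicator (fun _ => (Real.exp u)⁻¹) x = 1 := by
    rw [integral_indicator_Icc hb.le, sub_zero, mul_inv_cancel₀ hb.ne']
  have hfar := le_integral_abs_indicator_sub hu0 hu1
  refine ⟨(Icc 0 (lam + (1 - lam) * Real.exp u)).indicator fun _ => Real.exp u ^ (-(1 - lam)),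
    (Icc 0 1).indicator fun _ => 1, (Icc 0 (Real.exp u)).indicator fun _ => (Real.exp u)⁻¹,
    logConcave_indicator_Icc zero_le_one _ _, logConcave_indicator_Icc (by positivity) _ _,
    integrable_indicator_Icc _ _ _, integrable_indicator_Icc _ _ _, integrable_indicator_Icc _ _ _,
    hf1, hg1, (supConv_indicator hl hl1 hb).symm, indicator_rpow_mul_indicator_rpow_le hl hl1 hb,
    ?_, fun x₀ => ?_, fun a x₀ k ha _ hk => ?_⟩
  · rw [integral_indicator_Icc hL, sub_zero]
    have := exp_mix_lt hl hl1 hu0 hu1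
    rwa [hu2] at this
  · have := hfar x₀
    linarith
  -- Otherwise `d = u/16` in the preceding comparison would put `g` within `u/2` of a translate of
  -- `f`, against the lower bound `u`.
  · by_contra! hcon
    rw [hf1, hg1, mul_one] at hcon
    have := integral_abs_sub_translate_le ha (by linarith) (integrable_indicator_Icc _ _ _)
      (integrable_indicator_Icc _ _ _) hk (fun x => indicator_nonneg (fun _ _ => zero_le_one) x)
      hf1 hg1 hcon.1.le hcon.2.le
    have := hfar (-x₀)
    linarith

end Sharpness

/-! ### Change of variables and displacement of a unimodal function. -/

open Set in
/-- Change of variables along a monotone Lipschitz function. -/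
theorem lintegral_image_of_monotone_lipschitz {x : ℝ → ℝ} {K : NNReal} (hx : Monotone x)
    (hK : LipschitzWith K x) {s : Set ℝ} (hs : MeasurableSet s) (u : ℝ → ENNReal) :
    ∫⁻ v in x '' s, u v = ∫⁻ z in s, ENNReal.ofReal (deriv x z) * u (x z) := by
  set D : Set ℝ := {z | DifferentiableAt ℝ x z} with hD
  have hDm : MeasurableSet D := measurableSet_of_differentiableAt ℝ x
  have hD0 : volume Dᶜ = 0 := by
    have := hx.ae_differentiableAt
    rwa [ae_iff] at this
  -- The Lipschitz bound keeps the image of the non-differentiability set null.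
  have hnull : volume (x '' Dᶜ) = 0 := by
    have h := hK.hausdorffMeasure_image_le (d := 1) zero_le_one Dᶜ
    rw [hausdorffMeasure_real, hD0, mul_zero] at h
    exact le_antisymm h bot_le
  have h1 : x '' s =ᵐ[volume] x '' (s ∩ D) := by
    refine Filter.EventuallyLE.antisymm ?_ (image_mono inter_subset_left).eventuallyLE
    refine ae_le_set.2 (measure_mono_null ?_ hnull)
    rintro _ ⟨⟨z, hz, rfl⟩, h⟩
    exact ⟨z, fun hzD => h ⟨z, ⟨hz, hzD⟩, rfl⟩, rfl⟩
  have h2 : (s ∩ D : Set ℝ) =ᵐ[volume] s := by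
    refine inter_subset_left.eventuallyLE.antisymm (ae_le_set.2 (measure_mono_null ?_ hD0))
    rintro z ⟨hz, h⟩
    exact fun hzD => h ⟨hz, hzD⟩
  rw [setLIntegral_congr h1, lintegral_image_eq_lintegral_deriv_mul_of_monotoneOn (hs.inter hDm)
    (fun z hz => hz.2.hasDerivAt.hasDerivWithinAt) (hx.monotoneOn _), setLIntegral_congr h2]

open Set in
theorem image_Ioc_ae_eq {x : ℝ → ℝ} (hx : Monotone x) (hc : Continuous x) {a b : ℝ} (hab : a ≤ b) :
    x '' Ioc a b =ᵐ[volume] Ioc (x a) (x b) := by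
  refine Filter.EventuallyLE.antisymm ?_ (intermediate_value_Ioc hab hc.continuousOn).eventuallyLE
  refine Filter.EventuallyLE.trans ?_ Ioc_ae_eq_Icc.symm.le
  refine LE.le.eventuallyLE ?_
  rintro _ ⟨z, hz, rfl⟩
  exact ⟨hx hz.1.le, hx hz.2⟩

open Set in
/-- The mass that a monotone map fixing `0` moves out of an initial interval of `(0, ∞)`. -/
theorem lintegral_deriv_leaving_le {x : ℝ → ℝ} {K : NNReal} (hx : Monotone x)
    (hK : LipschitzWith K x) (h0 : x 0 = 0) {I : Set ℝ} (hI : MeasurableSet I) (hI0 : I ⊆ Ioi 0)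
    (hI1 : ∀ z ∈ I, ∀ w, 0 < w → w ≤ z → w ∈ I) (hxm : MeasurableSet (x ⁻¹' I)) :
    ∫⁻ z in I \ x ⁻¹' I, ENNReal.ofReal (deriv x z) ≤ ∫⁻ z in I, ENNReal.ofReal (deriv x z - 1) := by
  have hcov := fun s (hs : MeasurableSet s) =>
    lintegral_image_of_monotone_lipschitz hx hK hs (fun _ => 1)
  simp only [mul_one, setLIntegral_one] at hcov
  rw [← hcov _ (hI.diff hxm)]
  -- Either every point leaving `I` lands at `0`, or some image lies to the right of all of `I`.
  -- Then `I` has finite measure and `I ⊆ x(I)`, so the escaping mass is at most `|x(I)| - |I|`.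
  by_cases hle : ∀ z ∈ I, x z ∉ I → x z ≤ 0
  · have : x '' (I \ x ⁻¹' I) ⊆ {0} := by
      rintro _ ⟨z, hz, rfl⟩
      exact le_antisymm (hle z hz.1 hz.2) (h0 ▸ hx (hI0 hz.1).le)
    rw [measure_mono_null this (by simp)]
    exact bot_le
  · push Not at hle
    obtain ⟨z, hz, hxz, hpos⟩ := hle
    have hIlt : ∀ w ∈ I, w < x z := fun w hw => by
      by_contra h
      exact hxz (hI1 w hw _ hpos (not_lt.1 h))
    have hsub : I ⊆ x '' I := by
      intro w hw
      obtain ⟨v, hv, hvw⟩ := intermediate_value_Ioc (hI0 hz).le (f := x) hK.continuous.continuousOn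
        (show w ∈ Ioc (x 0) (x z) from ⟨h0.symm ▸ hI0 hw, (hIlt w hw).le⟩)
      exact ⟨v, hI1 z hz v hv.1 hv.2, hvw⟩
    have hfin : volume I ≠ ⊤ := by
      have : volume I ≤ volume (Ioc 0 (x z)) := measure_mono fun w hw => ⟨hI0 hw, (hIlt w hw).le⟩
      exact (this.trans_lt (by simp)).ne
    have hsub2 : x '' (I \ x ⁻¹' I) ⊆ x '' I \ I := by
      rintro _ ⟨z, hz, rfl⟩
      exact ⟨⟨z, hz.1, rfl⟩, hz.2⟩
    refine (measure_mono hsub2).trans ?_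
    rw [measure_sdiff hsub hI.nullMeasurableSet hfin, hcov _ hI, tsub_le_iff_right]
    calc ∫⁻ z in I, ENNReal.ofReal (deriv x z)
        ≤ ∫⁻ z in I, (ENNReal.ofReal (deriv x z - 1) + 1) := by
          refine lintegral_mono fun z => ?_
          simpa using ENNReal.ofReal_add_le (p := deriv x z - 1) (q := 1)
      _ = _ := by rw [lintegral_add_right _ measurable_const]; simp

open Set in
-- Layer cake: `(h z - h (x z))₊` is the length of the set of levels `t` for which `z` lies in the
-- superlevel set `I t` and `x z` does not. Apply the escaping-mass bound at each level and
-- integrate in `t`.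
theorem lintegral_Ioi_displacement_le {x h : ℝ → ℝ} {K : NNReal} (hx : Monotone x)
    (hK : LipschitzWith K x) (h0 : x 0 = 0) (hh : Measurable h) (hn : ∀ z, 0 ≤ h z)
    (ha : AntitoneOn h (Ioi 0)) :
    ∫⁻ z in Ioi 0, ENNReal.ofReal (deriv x z) * ENNReal.ofReal (h z - h (x z))
      ≤ ∫⁻ z in Ioi 0, ENNReal.ofReal (deriv x z - 1) * ENNReal.ofReal (h z) := by
  have hxm : Measurable x := hK.continuous.measurable
  have hdm : Measurable (deriv x) := measurable_deriv x
  let I : ℝ → Set ℝ := fun t => {z | 0 < z ∧ t < h z}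
  have hIm : ∀ t, MeasurableSet (I t) := fun t =>
    measurableSet_Ioi.inter (measurableSet_lt measurable_const hh)
  have key : ∀ t, ∫⁻ z in Ioi 0, (Ico (h (x z)) (h z)).indicator
        (fun _ => ENNReal.ofReal (deriv x z)) t
      ≤ ∫⁻ z in Ioi 0, (Ico 0 (h z)).indicator (fun _ => ENNReal.ofReal (deriv x z - 1)) t := by
    intro t
    by_cases ht : 0 ≤ t
    swap
    · refine le_of_eq_of_le ?_ bot_le
      refine (lintegral_congr fun z => ?_).trans lintegral_zero
      refine indicator_of_notMem (fun hz => ht ((hn _).trans hz.1)) _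
    have e1 : ∫⁻ z in Ioi 0, (Ico (h (x z)) (h z)).indicator
        (fun _ => ENNReal.ofReal (deriv x z)) t
        ≤ ∫⁻ z in I t \ x ⁻¹' I t, ENNReal.ofReal (deriv x z) := by
      rw [← lintegral_indicator measurableSet_Ioi,
        ← lintegral_indicator ((hIm t).diff (hxm (hIm t)))]
      refine lintegral_mono fun z => ?_
      by_cases hz : 0 < z
      · rw [indicator_of_mem (mem_Ioi.2 hz)]
        by_cases hzt : t ∈ Ico (h (x z)) (h z)
        · rw [indicator_of_mem hzt, indicator_of_mem]
          exact ⟨⟨hz, hzt.2⟩, fun hI => absurd hI.2 (not_lt.2 hzt.1)⟩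
        · rw [indicator_of_notMem hzt]; exact bot_le
      · rw [indicator_of_notMem (by simpa using hz)]; exact bot_le
    have e2 : ∫⁻ z in I t, ENNReal.ofReal (deriv x z - 1) =
        ∫⁻ z in Ioi 0, (Ico 0 (h z)).indicator (fun _ => ENNReal.ofReal (deriv x z - 1)) t := by
      rw [← lintegral_indicator measurableSet_Ioi, ← lintegral_indicator (hIm t)]
      refine lintegral_congr fun z => ?_
      by_cases hz : 0 < z
      · rw [indicator_of_mem (mem_Ioi.2 hz)]
        by_cases hzt : t < h z
        · rw [indicator_of_mem (show z ∈ I t from ⟨hz, hzt⟩),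
            indicator_of_mem (show t ∈ Ico 0 (h z) from ⟨ht, hzt⟩)]
        · rw [indicator_of_notMem (fun hI : z ∈ I t => hzt hI.2),
            indicator_of_notMem (fun hI : t ∈ Ico 0 (h z) => hzt hI.2)]
      · rw [indicator_of_notMem (fun hI : z ∈ I t => hz hI.1),
          indicator_of_notMem (fun hI : z ∈ Ioi (0 : ℝ) => hz hI)]
    rw [← e2]
    refine e1.trans (lintegral_deriv_leaving_le hx hK h0 (hIm t) (fun z hz => hz.1) ?_
      (hxm (hIm t)))
    rintro z ⟨hz, hzt⟩ w hw hwz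
    exact ⟨hw, hzt.trans_le (ha hw hz hwz)⟩
  have swap : ∀ (l : ℝ → ℝ) (c : ℝ → ENNReal), Measurable l → Measurable c →
      ∫⁻ t, ∫⁻ z in Ioi 0, (Ico (l z) (h z)).indicator (fun _ => c z) t
        = ∫⁻ z in Ioi 0, c z * ENNReal.ofReal (h z - l z) := by
    intro l c hl hc
    rw [lintegral_lintegral_swap]
    · refine lintegral_congr fun z => ?_
      rw [lintegral_indicator_const measurableSet_Ico, Real.volume_Ico]
    · have hS : MeasurableSet {p : ℝ × ℝ | l p.2 ≤ p.1 ∧ p.1 < h p.2} :=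
        (measurableSet_le (hl.comp measurable_snd) measurable_fst).inter
          (measurableSet_lt measurable_fst (hh.comp measurable_snd))
      have : (Function.uncurry fun t z => (Ico (l z) (h z)).indicator (fun _ => c z) t)
          = {p : ℝ × ℝ | l p.2 ≤ p.1 ∧ p.1 < h p.2}.indicator (fun p => c p.2) := by
        ext ⟨t, z⟩
        simp only [Function.uncurry, indicator, mem_Ico, mem_ofPred_eq]
      rw [this]
      exact ((hc.comp measurable_snd).indicator hS).aemeasurable
  have s1 := swap (fun z => h (x z)) (fun z => ENNReal.ofReal (deriv x z)) (hh.comp hxm)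
    hdm.ennreal_ofReal
  have s2 := swap (fun _ => 0) (fun z => ENNReal.ofReal (deriv x z - 1)) measurable_const
    (hdm.sub_const 1).ennreal_ofReal
  simp only [sub_zero] at s2
  rw [← s1, ← s2]
  exact lintegral_mono key

open Set in
theorem lintegral_displacement_le {x h : ℝ → ℝ} {K : NNReal} (hx : Monotone x)
    (hK : LipschitzWith K x) (h0 : x 0 = 0) (hh : Measurable h) (hn : ∀ z, 0 ≤ h z)
    (hm : MonotoneOn h (Iio 0)) (ha : AntitoneOn h (Ioi 0)) :
    ∫⁻ z, ENNReal.ofReal (deriv x z) * ENNReal.ofReal (h z - h (x z))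
      ≤ ∫⁻ z, ENNReal.ofReal (deriv x z - 1) * ENNReal.ofReal (h z) := by
  have split : ∀ u : ℝ → ENNReal, ∫⁻ z, u z = (∫⁻ z in Ioi 0, u (-z)) + ∫⁻ z in Ioi 0, u z := by
    intro u
    rw [← lintegral_add_compl u (measurableSet_Iio (a := (0 : ℝ))), compl_Iio,
      ← setLIntegral_congr (Ioi_ae_eq_Ici (μ := volume) (a := (0 : ℝ)))]
    congr 1
    have := (Measure.measurePreserving_neg (volume : Measure ℝ)).setLIntegral_comp_preimage_emb
      (MeasurableEquiv.neg ℝ).measurableEmbedding u (Iio 0)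
    rw [← this]
    simp
  rw [split, split (fun z => ENNReal.ofReal (deriv x z - 1) * ENNReal.ofReal (h z))]
  refine add_le_add ?_ (lintegral_Ioi_displacement_le hx hK h0 hh hn ha)
  have hd : ∀ z, deriv (fun w => -x (-w)) z = deriv x (-z) := by
    intro z
    rw [deriv.fun_neg, deriv_comp_neg, neg_neg]
  have := lintegral_Ioi_displacement_le (x := fun w => -x (-w)) (h := fun w => h (-w)) (K := K)
    (fun a b hab => neg_le_neg (hx (neg_le_neg hab)))
    (by
      refine LipschitzWith.of_dist_le_mul fun a b => ?_
      have := hK.dist_le_mul (-a) (-b)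
      simpa [dist_neg_neg] using this)
    (by simp [h0]) (hh.comp measurable_neg) (fun z => hn _)
    (fun a ha b hb hab => hm (by simpa using hb) (by simpa using ha) (neg_le_neg hab))
  simpa only [hd, neg_neg] using this

/-! ### The monotone coupling and its transported density. -/

open Set Filter Topology in
-- Take `x z` to be the least `v` with `G ((z - lam v)/mu) ≤ F v`. Such a choice is canonical even
-- where `F` and `G` are flat, which is what makes both maps monotone.
theorem exists_monotone_coupling {lam mu : ℝ} (hl : 0 < lam) (hm : 0 < mu) {F G : ℝ → ℝ}
    (hFm : Monotone F) (hGm : Monotone G) (hF : Continuous F) (hG : Continuous G)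
    (hF0 : Tendsto F atBot (𝓝 0)) (hF1 : Tendsto F atTop (𝓝 1))
    (hG0 : Tendsto G atBot (𝓝 0)) (hG1 : Tendsto G atTop (𝓝 1)) :
    ∃ x y : ℝ → ℝ, Monotone x ∧ Monotone y ∧ (∀ z, lam * x z + mu * y z = z) ∧
      ∀ z, F (x z) = G (y z) := by
  let Y : ℝ → ℝ → ℝ := fun z v => (z - lam * v) / mu
  have hYc : ∀ z, Continuous (Y z) := fun z => by fun_prop
  let S : ℝ → Set ℝ := fun z => {v | G (Y z v) ≤ F v}
  have hYbot : ∀ z, Tendsto (Y z) atTop atBot := fun z =>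
    (tendsto_atBot_add_const_left atTop z
      (tendsto_neg_atTop_atBot.comp (tendsto_id.const_mul_atTop hl))).atBot_div_const hm
      |>.congr fun v => by simp [Y, sub_eq_add_neg]
  have hYtop : ∀ z, Tendsto (Y z) atBot atTop := fun z =>
    (tendsto_atTop_add_const_left atBot z
      (tendsto_neg_atBot_atTop.comp (tendsto_id.const_mul_atBot hl))).atTop_div_const hm
      |>.congr fun v => by simp [Y, sub_eq_add_neg]
  have hSc : ∀ z, IsClosed (S z) := fun z => isClosed_le (hG.comp (hYc z)) hF
  have hSne : ∀ z, (S z).Nonempty := by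
    intro z
    have h1 : ∀ᶠ v in atTop, G (Y z v) < 1 / 2 :=
      (hG0.comp (hYbot z)).eventually_lt_const (by norm_num)
    have h2 : ∀ᶠ v in atTop, 1 / 2 < F v := hF1.eventually_const_lt (by norm_num)
    obtain ⟨v, hv⟩ := (h1.and h2).exists
    exact ⟨v, (hv.1.trans hv.2).le⟩
  have hSb : ∀ z, BddBelow (S z) := by
    intro z
    have h1 : ∀ᶠ v in atBot, 1 / 2 < G (Y z v) :=
      (hG1.comp (hYtop z)).eventually_const_lt (by norm_num)
    have h2 : ∀ᶠ v in atBot, F v < 1 / 2 := hF0.eventually_lt_const (by norm_num)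
    obtain ⟨v, hv⟩ := eventually_atBot.1 (h1.and h2)
    refine ⟨v, fun w hw => ?_⟩
    by_contra h
    have := hv w (not_le.1 h).le
    exact absurd (show G (Y z w) ≤ F w from hw) (not_le.2 (this.2.trans this.1))
  have hmem : ∀ z, sInf (S z) ∈ S z := fun z => (hSc z).csInf_mem (hSne z) (hSb z)
  have hYeq : ∀ z v, lam * v + mu * Y z v = z := fun z v => by
    simp only [Y]; field_simp; ring
  have hxm : Monotone fun z => sInf (S z) := by
    intro z w hzw
    refine csInf_le (hSb z) ?_
    refine le_trans (hGm ?_) (hmem w)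
    exact div_le_div_of_nonneg_right (by linarith) hm.le
  refine ⟨fun z => sInf (S z), fun z => Y z (sInf (S z)), hxm, ?_, fun z => hYeq _ _, fun z => ?_⟩
  · intro z w hzw
    -- Moving `v` by `(w - z)/lam` leaves the second coordinate unchanged and can only increase `F
    -- v`.
    have h1 : sInf (S w) ≤ sInf (S z) + (w - z) / lam := by
      refine csInf_le (hSb w) ?_
      have e : Y w (sInf (S z) + (w - z) / lam) = Y z (sInf (S z)) := by
        simp only [Y]; congr 1; field_simp; ring
      change G _ ≤ F _
      rw [e]
      refine (hmem z).trans (hFm ?_)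
      have : 0 ≤ (w - z) / lam := div_nonneg (by linarith) hl.le
      linarith
    refine div_le_div_of_nonneg_right ?_ hm.le
    have h2 : lam * sInf (S w) ≤ lam * (sInf (S z) + (w - z) / lam) :=
      mul_le_mul_of_nonneg_left h1 hl.le
    have h3 : lam * ((w - z) / lam) = w - z := by field_simp
    linarith
  · refine le_antisymm ?_ (hmem z)
    by_contra! h
    have hev : ∀ᶠ v in 𝓝 (sInf (S z)), G (Y z v) < F v :=
      (hG.comp (hYc z)).continuousAt.eventually_lt hF.continuousAt h
    obtain ⟨v, hv, hlt⟩ := ((hev.filter_mono nhdsWithin_le_nhds).and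
      (self_mem_nhdsWithin (a := sInf (S z)) (s := Iio (sInf (S z))))).exists
    exact absurd (csInf_le (hSb z) (show v ∈ S z from hv.le)) (not_le.2 hlt)

theorem lipschitzWith_of_coupling {lam mu : ℝ} (hl : 0 < lam) (hm : 0 < mu) {x y : ℝ → ℝ}
    (hx : Monotone x) (hy : Monotone y) (hz : ∀ z, lam * x z + mu * y z = z) :
    LipschitzWith (1 / lam).toNNReal x := by
  refine LipschitzWith.of_le_add_mul _ fun z w => ?_
  rw [Real.coe_toNNReal _ (by positivity), Real.dist_eq]
  rcases le_total w z with h | h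
  · have h1 := mul_le_mul_of_nonneg_left (hy h) hm.le
    have h2 := hz z
    have h3 := hz w
    rw [abs_of_nonneg (by linarith), ← sub_le_iff_le_add', one_div, inv_mul_eq_div, le_div_iff₀ hl]
    linarith
  · have := hx h
    have : 0 ≤ 1 / lam * |z - w| := by positivity
    linarith

section Cumulative

open Set Filter Topology

variable {f : ℝ → ℝ}

theorem monotone_integral_Iic (hf : Integrable f) (h0 : ∀ v, 0 ≤ f v) :
    Monotone fun v => ∫ t in Iic v, f t := fun _ _ hab =>
  setIntegral_mono_set hf.integrableOn (ae_of_all _ h0) (Iic_subset_Iic.2 hab).eventuallyLE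

theorem continuous_integral_Iic (hf : Integrable f) : Continuous fun v => ∫ t in Iic v, f t := by
  have : (fun v => ∫ t in Iic v, f t) = fun v => (∫ t in Iic 0, f t) + ∫ t in (0 : ℝ)..v, f t := by
    ext v
    rw [← intervalIntegral.integral_Iic_sub_Iic hf.integrableOn hf.integrableOn]
    ring
  rw [this]
  exact continuous_const.add (hf.continuous_primitive 0)

theorem tendsto_integral_Iic_atTop (hf : Integrable f) :
    Tendsto (fun v => ∫ t in Iic v, f t) atTop (𝓝 (∫ t, f t)) :=
  (aecover_Iic tendsto_id).integral_tendsto_of_countably_generated hf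

theorem setLIntegral_deriv_mul_comp {x : ℝ → ℝ} {K : NNReal} (hx : Monotone x)
    (hK : LipschitzWith K x) (hf : Integrable f) (h0 : ∀ v, 0 ≤ f v) {a b : ℝ} (hab : a ≤ b) :
    ∫⁻ z in Ioc a b, ENNReal.ofReal (deriv x z) * ENNReal.ofReal (f (x z))
      = ENNReal.ofReal ((∫ t in Iic (x b), f t) - ∫ t in Iic (x a), f t) := by
  rw [← lintegral_image_of_monotone_lipschitz hx hK measurableSet_Ioc (fun v => ENNReal.ofReal (f v)),
    setLIntegral_congr (image_Ioc_ae_eq hx hK.continuous hab),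
    intervalIntegral.integral_Iic_sub_Iic hf.integrableOn hf.integrableOn,
    intervalIntegral.integral_of_le (hx hab),
    ofReal_integral_eq_lintegral_ofReal hf.integrableOn (ae_of_all _ h0)]

end Cumulative

section Coupling

open Set Filter Topology

variable {lam mu : ℝ} {f g x y : ℝ → ℝ}

/-- No mass is lost although `x` need not be onto: `z` lies between `x z` and `y z`, so `F (x z)`
lies between the minimum and the maximum of `F z` and `G z`, hence runs from 0 to 1. -/
theorem lintegral_deriv_mul_comp_of_coupling (hl : 0 < lam) (hm : 0 < mu) (hs : lam + mu = 1)
    (hf : Integrable f) (hf0 : ∀ v, 0 ≤ f v) (hf1 : ∫ v, f v = 1)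
    (hg : Integrable g) (hg0 : ∀ v, 0 ≤ g v) (hg1 : ∫ v, g v = 1)
    (hx : Monotone x) (hy : Monotone y) (hz : ∀ z, lam * x z + mu * y z = z)
    (hFG : ∀ z, ∫ t in Iic (x z), f t = ∫ t in Iic (y z), g t) :
    ∫⁻ z, ENNReal.ofReal (deriv x z) * ENNReal.ofReal (f (x z)) = 1 := by
  have hK := lipschitzWith_of_coupling hl hm hx hy hz
  apply le_antisymm
  · rw [← setLIntegral_univ, ← lintegral_image_of_monotone_lipschitz hx hK MeasurableSet.univ
      (fun v => ENNReal.ofReal (f v))]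
    refine (setLIntegral_le_lintegral _ _).trans ?_
    rw [← ofReal_integral_eq_lintegral_ofReal hf (ae_of_all _ hf0), hf1, ENNReal.ofReal_one]
  · set F : ℝ → ℝ := fun v => ∫ t in Iic v, f t
    set G : ℝ → ℝ := fun v => ∫ t in Iic v, g t
    have hFm : Monotone F := monotone_integral_Iic hf hf0
    have hGm : Monotone G := monotone_integral_Iic hg hg0
    have hge : ∀ z, min (F z) (G z) ≤ F (x z) := by
      intro z
      by_cases h : z ≤ x z
      · exact (min_le_left _ _).trans (hFm h)
      · have : z ≤ y z := by
          by_contra h'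
          have h1 := mul_lt_mul_of_pos_left (not_le.1 h) hl
          have h2 := mul_lt_mul_of_pos_left (not_le.1 h') hm
          have h3 : lam * z + mu * z = z := by rw [← add_mul, hs, one_mul]
          linarith [hz z]
        exact (min_le_right _ _).trans ((hGm this).trans (hFG z).ge)
    have hle : ∀ z, F (x z) ≤ max (F z) (G z) := by
      intro z
      by_cases h : x z ≤ z
      · exact (hFm h).trans (le_max_left _ _)
      · have : y z ≤ z := by
          by_contra h'
          have h1 := mul_lt_mul_of_pos_left (not_le.1 h) hl
          have h2 := mul_lt_mul_of_pos_left (not_le.1 h') hm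
          have h3 : lam * z + mu * z = z := by rw [← add_mul, hs, one_mul]
          linarith [hz z]
        exact ((hFG z).le.trans (hGm this)).trans (le_max_right _ _)
    have htop : Tendsto (fun r => min (F r) (G r)) atTop (𝓝 1) := by
      simpa [hf1, hg1] using (tendsto_integral_Iic_atTop hf).min (tendsto_integral_Iic_atTop hg)
    have hbot : Tendsto (fun r => max (F (-r)) (G (-r))) atTop (𝓝 0) := by
      have hbf : Tendsto F atBot (𝓝 0) := tendsto_integral_Iic_zero tendsto_id
      have hbg : Tendsto G atBot (𝓝 0) := tendsto_integral_Iic_zero tendsto_id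
      simpa using (hbf.comp tendsto_neg_atTop_atBot).max (hbg.comp tendsto_neg_atTop_atBot)
    have hlim := ENNReal.tendsto_ofReal (htop.sub hbot)
    simp only [sub_zero, ENNReal.ofReal_one] at hlim
    refine le_of_tendsto hlim ?_
    filter_upwards [eventually_ge_atTop 0] with r hr
    refine le_trans (ENNReal.ofReal_le_ofReal (sub_le_sub (hge r) (hle (-r)))) ?_
    rw [← setLIntegral_deriv_mul_comp hx hK hf hf0 (by linarith)]
    exact setLIntegral_le_lintegral _ _

/-- Both sides are densities of one finite measure, since they give each `Ioc` the same mass. -/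
theorem ae_deriv_mul_comp_eq_of_coupling (hl : 0 < lam) (hm : 0 < mu) (hs : lam + mu = 1)
    (hf : Integrable f) (hf0 : ∀ v, 0 ≤ f v) (hf1 : ∫ v, f v = 1) (hfm : Measurable f)
    (hg : Integrable g) (hg0 : ∀ v, 0 ≤ g v) (hg1 : ∫ v, g v = 1) (hgm : Measurable g)
    (hx : Monotone x) (hy : Monotone y) (hz : ∀ z, lam * x z + mu * y z = z)
    (hFG : ∀ z, ∫ t in Iic (x z), f t = ∫ t in Iic (y z), g t) :
    ∀ᵐ z, deriv x z * f (x z) = deriv y z * g (y z) := by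
  have hz' : ∀ z, mu * y z + lam * x z = z := fun z => by rw [add_comm, hz]
  have hKx := lipschitzWith_of_coupling hl hm hx hy hz
  have hKy := lipschitzWith_of_coupling hm hl hy hx hz'
  have hmx : Measurable fun z => ENNReal.ofReal (deriv x z) * ENNReal.ofReal (f (x z)) :=
    (measurable_deriv x).ennreal_ofReal.mul (hfm.comp hKx.continuous.measurable).ennreal_ofReal
  have hmy : Measurable fun z => ENNReal.ofReal (deriv y z) * ENNReal.ofReal (g (y z)) :=
    (measurable_deriv y).ennreal_ofReal.mul (hgm.comp hKy.continuous.measurable).ennreal_ofReal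
  have hIx := lintegral_deriv_mul_comp_of_coupling hl hm hs hf hf0 hf1 hg hg0 hg1 hx hy hz hFG
  have : IsFiniteMeasure (volume.withDensity
      fun z => ENNReal.ofReal (deriv x z) * ENNReal.ofReal (f (x z))) :=
    isFiniteMeasure_withDensity (by rw [hIx]; exact ENNReal.one_ne_top)
  have heq : volume.withDensity (fun z => ENNReal.ofReal (deriv x z) * ENNReal.ofReal (f (x z)))
      = volume.withDensity (fun z => ENNReal.ofReal (deriv y z) * ENNReal.ofReal (g (y z))) := by
    refine Measure.ext_of_Ioc _ _ fun a b hab => ?_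
    rw [withDensity_apply _ measurableSet_Ioc, withDensity_apply _ measurableSet_Ioc,
      setLIntegral_deriv_mul_comp hx hKx hf hf0 hab.le,
      setLIntegral_deriv_mul_comp hy hKy hg hg0 hab.le, hFG, hFG]
  rw [withDensity_eq_iff hmx.aemeasurable hmy.aemeasurable (by rw [hIx]; exact ENNReal.one_ne_top)]
    at heq
  filter_upwards [heq] with z h
  have h1 : 0 ≤ deriv x z := hx.deriv_nonneg
  have h2 : 0 ≤ deriv y z := hy.deriv_nonneg
  rw [← ENNReal.ofReal_mul h1, ← ENNReal.ofReal_mul h2] at h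
  exact (ENNReal.ofReal_eq_ofReal_iff (mul_nonneg h1 (hf0 _)) (mul_nonneg h2 (hg0 _))).1 h

theorem ae_deriv_coupling (hx : Monotone x) (hy : Monotone y)
    (hz : ∀ z, lam * x z + mu * y z = z) : ∀ᵐ z, lam * deriv x z + mu * deriv y z = 1 := by
  filter_upwards [hx.ae_differentiableAt, hy.ae_differentiableAt] with z h1 h2
  have h := (h1.hasDerivAt.const_mul lam).add (h2.hasDerivAt.const_mul mu)
  exact h.unique ((hasDerivAt_id z).congr_of_eventuallyEq (Eventually.of_forall hz))

end Coupling

open Set in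
-- The map need not fix the mode `m`; the shift `m - x m` corrects for this and is the translation
-- in the final estimate.
theorem lintegral_displacement_about_le {x h : ℝ → ℝ} {K : NNReal} (hx : Monotone x)
    (hK : LipschitzWith K x) (hh : Measurable h) (hn : ∀ z, 0 ≤ h z) (m : ℝ)
    (hm : MonotoneOn h (Iio m)) (ha : AntitoneOn h (Ioi m)) :
    ∫⁻ z, ENNReal.ofReal (deriv x z) * ENNReal.ofReal (h z - h (x z + (m - x m)))
      ≤ ∫⁻ z, ENNReal.ofReal (deriv x z - 1) * ENNReal.ofReal (h z) := by
  have hd : ∀ z, deriv (fun w => x (w + m) - x m) z = deriv x (z + m) := by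
    intro z
    rw [deriv_sub_const, deriv_comp_add_const]
  have key := lintegral_displacement_le (x := fun w => x (w + m) - x m) (h := fun w => h (w + m))
    (K := K) (fun a b hab => sub_le_sub_right (hx (by linarith)) _)
    (by
      refine LipschitzWith.of_dist_le_mul fun a b => ?_
      have := hK.dist_le_mul (a + m) (b + m)
      simpa using this)
    (by simp) (hh.comp (measurable_add_const m)) (fun z => hn _)
    (fun a ha b hb hab => hm (by simpa using ha) (by simpa using hb) (by linarith))
    (fun a ha' b hb hab => ha (by simpa using ha') (by simpa using hb) (by linarith))
  simp only [hd] at key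
  rw [← lintegral_add_right_eq_self _ m]
  rw [← lintegral_add_right_eq_self (fun z => ENNReal.ofReal (deriv x z - 1) * ENNReal.ofReal (h z)) m]
  refine le_of_eq_of_le (lintegral_congr fun z => ?_) key
  rw [show x (z + m) - x m + m = x (z + m) + (m - x m) by ring]

/-! ### Pointwise deficit in the arithmetic-geometric mean inequality. -/

/-- With `r = √a`, `log a ≤ 2(r - 1)` gives `(r - 1)² ≤ a - 1 - log a`; the other factor `(r + 1)²`
grows only linearly in `a`. -/
theorem sq_div_le_sub_one_sub_log {a : ℝ} (ha : 0 < a) :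
    (a - 1) ^ 2 ≤ 4 * (1 + |a - 1|) * (a - 1 - Real.log a) := by
  set r := Real.sqrt a with hr
  have hr0 : 0 < r := Real.sqrt_pos.2 ha
  have har : a = r ^ 2 := (Real.sq_sqrt ha.le).symm
  have hlog : Real.log a ≤ 2 * (r - 1) := by
    rw [har, Real.log_pow]
    have := Real.log_le_sub_one_of_pos hr0
    push_cast
    linarith
  have h1 : (r - 1) ^ 2 ≤ a - 1 - Real.log a := by nlinarith
  have h2 : (r + 1) ^ 2 ≤ 4 * (1 + |a - 1|) := by
    have := le_abs_self (a - 1)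
    have := abs_nonneg (a - 1)
    nlinarith [sq_nonneg (r - 1)]
  calc (a - 1) ^ 2 = (r + 1) ^ 2 * (r - 1) ^ 2 := by rw [har]; ring
    _ ≤ _ := mul_le_mul h2 h1 (sq_nonneg _) (by positivity)

/-- The quantitative arithmetic-geometric mean step: `a` and `b` are the derivatives of the two
transport maps, and `a * p = b * q` is the transported density. -/
theorem density_le_and_deficit {lam mu a b p q H : ℝ} (hl : 0 < lam) (hm : 0 < mu)
    (hs : lam + mu = 1) (ha : 0 ≤ a) (hb : 0 ≤ b) (hab : lam * a + mu * b = 1) (hp : 0 ≤ p)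
    (hq : 0 ≤ q) (hpq : a * p = b * q) (hH : p ^ lam * q ^ mu ≤ H) :
    a * p ≤ H ∧ lam * (a * p) * (a - 1) ^ 2 ≤ 4 * (1 + |a - 1|) * (H - a * p) := by
  have hH0 : 0 ≤ H := le_trans (by positivity) hH
  rcases (mul_nonneg ha hp).eq_or_lt with h0 | hpos
  · rw [← h0]
    refine ⟨hH0, ?_⟩
    have : 0 ≤ 4 * (1 + |a - 1|) * (H - 0) := by
      have := abs_nonneg (a - 1)
      rw [sub_zero]; positivity
    simpa using this
  have ha' : 0 < a := ha.lt_of_ne fun h => by simp [← h] at hpos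
  have hp' : 0 < p := hp.lt_of_ne fun h => by simp [← h] at hpos
  have hpos' := hpq ▸ hpos
  have hb' : 0 < b := hb.lt_of_ne fun h => by simp [← h] at hpos'
  have hq' : 0 < q := hq.lt_of_ne fun h => by simp [← h] at hpos'
  set L := a - 1 - Real.log a with hL
  have hL0 : 0 ≤ L := by have := Real.log_le_sub_one_of_pos ha'; linarith
  have hfac : p ^ lam * q ^ mu = a * p * Real.exp (-(lam * Real.log a + mu * Real.log b)) := by
    have e1 : Real.log p = Real.log (a * p) - Real.log a := by
      rw [Real.log_mul ha'.ne' hp'.ne']; ring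
    have e2 : Real.log q = Real.log (a * p) - Real.log b := by
      rw [hpq, Real.log_mul hb'.ne' hq'.ne']; ring
    rw [Real.rpow_def_of_pos hp', Real.rpow_def_of_pos hq', ← Real.exp_add]
    have e3 : Real.log p * lam + Real.log q * mu
        = Real.log (a * p) + -(lam * Real.log a + mu * Real.log b) := by
      rw [e1, e2]
      linear_combination Real.log (a * p) * hs
    rw [e3, Real.exp_add, Real.exp_log hpos]
  -- Use `log b ≤ b - 1` and `mu (b - 1) = -lam (a - 1)`, so that only `a` remains.
  have hexp : 1 + lam * L ≤ Real.exp (-(lam * Real.log a + mu * Real.log b)) := by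
    have h1 := Real.add_one_le_exp (-(lam * Real.log a + mu * Real.log b))
    have h2 := mul_le_mul_of_nonneg_left (Real.log_le_sub_one_of_pos hb') hm.le
    have h3 : lam * L = lam * a - lam - lam * Real.log a := by rw [hL]; ring
    linarith
  have hmain : a * p * (1 + lam * L) ≤ H :=
    (mul_le_mul_of_nonneg_left hexp hpos.le).trans (hfac ▸ hH)
  have hdel : lam * (a * p) * L ≤ H - a * p := by linarith
  have hLnn : 0 ≤ lam * (a * p) * L := by positivity
  refine ⟨by linarith, ?_⟩
  calc lam * (a * p) * (a - 1) ^ 2 ≤ lam * (a * p) * (4 * (1 + |a - 1|) * L) :=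
        mul_le_mul_of_nonneg_left (sq_div_le_sub_one_sub_log ha') (by positivity)
    _ = 4 * (1 + |a - 1|) * (lam * (a * p) * L) := by ring
    _ ≤ _ := mul_le_mul_of_nonneg_left hdel (by positivity)

/-- Where `|a - 1| ≤ eta` the cost is `eta r`; elsewhere `(1 + |a - 1|)/|a - 1| ≤ 1 + 1/eta` makes
the deficit bound linear. Exchanging `H` for `r` costs a further `(H - r)/lam`, as `a ≤ 1/lam`;
hence 5 and not 4. -/
theorem mul_posPart_add_mul_posPart_le {lam a r H eta : ℝ} (hl : 0 < lam) (heta : 0 < eta)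
    (hla : lam * a ≤ 1) (hr : 0 ≤ r) (hrH : r ≤ H)
    (hdef : lam * r * (a - 1) ^ 2 ≤ 4 * (1 + |a - 1|) * (H - r)) :
    r * max (1 - a) 0 + H * max (a - 1) 0 ≤ eta * r + (5 + 4 / eta) / lam * (H - r) := by
  set d := H - r with hd
  have hd0 : 0 ≤ d := sub_nonneg.2 hrH
  have h1 : r * |a - 1| ≤ eta * r + (4 + 4 / eta) / lam * d := by
    by_cases hs : |a - 1| ≤ eta
    · have : 0 ≤ (4 + 4 / eta) / lam * d := by positivity
      nlinarith
    · push Not at hs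
      have hpos : 0 < |a - 1| := heta.trans hs
      rw [← sq_abs] at hdef
      have h2 : lam * (r * |a - 1|) ≤ (4 + 4 / eta) * d := by
        refine le_of_mul_le_mul_right ?_ hpos
        calc lam * (r * |a - 1|) * |a - 1| = lam * r * |a - 1| ^ 2 := by ring
          _ ≤ 4 * (1 + |a - 1|) * d := hdef
          _ ≤ (4 + 4 / eta) * d * |a - 1| := by
            have h3 : 1 ≤ |a - 1| / eta := (one_le_div heta).2 hs.le
            have : (4 + 4 / eta) * d * |a - 1| = 4 * d * (|a - 1| + |a - 1| / eta) := by ring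
            rw [this]
            nlinarith [mul_le_mul_of_nonneg_left h3 hd0]
      have : r * |a - 1| ≤ (4 + 4 / eta) / lam * d := by
        rw [div_mul_eq_mul_div, le_div_iff₀ hl]; linarith
      have : 0 ≤ eta * r := by positivity
      linarith
  have h2 : max (a - 1) 0 ≤ 1 / lam := by
    refine max_le ?_ (by positivity)
    rw [le_div_iff₀ hl]; linarith
  have h3 : d * max (a - 1) 0 ≤ 1 / lam * d := by
    rw [mul_comm]; exact mul_le_mul_of_nonneg_right h2 hd0
  have h4 : max (1 - a) 0 + max (a - 1) 0 = |a - 1| := by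
    rcases le_total a 1 with h | h
    · rw [max_eq_left (by linarith), max_eq_right (by linarith), abs_of_nonpos (by linarith)]; ring
    · rw [max_eq_right (by linarith), max_eq_left (by linarith), abs_of_nonneg (by linarith)]; ring
  have h5 : (5 + 4 / eta) / lam * d = (4 + 4 / eta) / lam * d + 1 / lam * d := by ring
  calc r * max (1 - a) 0 + H * max (a - 1) 0
      = r * (max (1 - a) 0 + max (a - 1) 0) + d * max (a - 1) 0 := by rw [hd]; ring
    _ ≤ _ := by rw [h4, h5]; linarith

theorem ae_eq_zero_of_setIntegral_eq {f : ℝ → ℝ} (hf : Integrable f) (h0 : ∀ v, 0 ≤ f v)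
    {s : Set ℝ} (hs : MeasurableSet s) (h : ∫ v, f v ≤ ∫ v in s, f v) : ∀ᵐ v, v ∉ s → f v = 0 := by
  have h1 := integral_add_compl hs hf
  have h2 : ∫ v in sᶜ, f v = 0 :=
    le_antisymm (by linarith) (setIntegral_nonneg hs.compl fun v _ => h0 v)
  rw [setIntegral_eq_zero_iff_of_nonneg_ae (ae_of_all _ h0) hf.integrableOn] at h2
  exact (ae_restrict_iff' hs.compl).1 h2

/-! ### From the coupling to an L¹ estimate. -/

section Coupling

open Set Filter Topology

variable {lam mu : ℝ} {f g h x y : ℝ → ℝ}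

theorem integral_abs_sub_translate_le_of_coupling (hl : 0 < lam) (hm : 0 < mu) (hs : lam + mu = 1)
    (hf : Integrable f) (hf0 : ∀ v, 0 ≤ f v) (hf1 : ∫ v, f v = 1) (hfm : Measurable f)
    (hg : Integrable g) (hg0 : ∀ v, 0 ≤ g v) (hg1 : ∫ v, g v = 1) (hgm : Measurable g)
    (hh : Integrable h) (hh0 : ∀ v, 0 ≤ h v) (hhm : Measurable h)
    (hPL : ∀ v w, f v ^ lam * g w ^ mu ≤ h (lam * v + mu * w))
    (hx : Monotone x) (hy : Monotone y) (hz : ∀ z, lam * x z + mu * y z = z)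
    (hFG : ∀ z, ∫ t in Iic (x z), f t = ∫ t in Iic (y z), g t) :
    1 ≤ ∫ z, h z ∧ ∀ m eta : ℝ, MonotoneOn h (Iio m) → AntitoneOn h (Ioi m) → 0 < eta →
      ∫ v, |f v - h (v + (m - x m))|
        ≤ (∫ z, h z) - 1 + 2 * (eta + (5 + 4 / eta) / lam * ((∫ z, h z) - 1)) := by
  have hK := lipschitzWith_of_coupling hl hm hx hy hz
  have hxm : Measurable x := hK.continuous.measurable
  have hdm : Measurable (deriv x) := measurable_deriv x
  set rho : ℝ → ℝ := fun z => deriv x z * f (x z) with hrho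
  have hrm : Measurable rho := hdm.mul (hfm.comp hxm)
  have hr0 : ∀ z, 0 ≤ rho z := fun z => mul_nonneg hx.deriv_nonneg (hf0 _)
  have hrl : ∫⁻ z, ENNReal.ofReal (rho z) = 1 := by
    rw [← lintegral_deriv_mul_comp_of_coupling hl hm hs hf hf0 hf1 hg hg0 hg1 hx hy hz hFG]
    exact lintegral_congr fun z => ENNReal.ofReal_mul hx.deriv_nonneg
  have hri : Integrable rho := by
    refine ⟨hrm.aestronglyMeasurable, ?_⟩
    rw [hasFiniteIntegral_iff_ofReal (ae_of_all _ hr0), hrl]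
    exact ENNReal.one_lt_top
  have hr1 : ∫ z, rho z = 1 := by
    rw [integral_eq_lintegral_of_nonneg_ae (ae_of_all _ hr0) hri.1, hrl, ENNReal.toReal_one]
  have hpt : ∀ᵐ z, lam * deriv x z ≤ 1 ∧ rho z ≤ h z ∧ lam * rho z * (deriv x z - 1) ^ 2
      ≤ 4 * (1 + |deriv x z - 1|) * (h z - rho z) := by
    filter_upwards [ae_deriv_coupling hx hy hz, ae_deriv_mul_comp_eq_of_coupling hl hm hs hf hf0
      hf1 hfm hg hg0 hg1 hgm hx hy hz hFG] with z h1 h2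
    have hb : 0 ≤ deriv y z := hy.deriv_nonneg
    refine ⟨by nlinarith, density_le_and_deficit hl hm hs hx.deriv_nonneg hb h1 (hf0 _) (hg0 (y z)) h2 ?_⟩
    have := hPL (x z) (y z)
    rwa [hz] at this
  have hrh : ∀ᵐ z, rho z ≤ h z := hpt.mono fun z h => h.2.1
  refine ⟨hr1 ▸ integral_mono_ae hri hh hrh, fun m eta hm1 hm2 heta => ?_⟩
  set k : ℝ → ℝ := fun v => h (v + (m - x m)) with hk
  have hki : Integrable k := hh.comp_add_right _
  have hk1 : ∫ v, k v = ∫ z, h z := integral_add_right_eq_self h _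
  have hrange : MeasurableSet (range x) := by
    have : IsPreconnected (range x) := isPreconnected_range hK.continuous
    exact this.ordConnected.measurableSet
  -- The range of `x` already carries the full mass of `f`, so `(f - k)₊` can be pulled back through
  -- `x` without loss.
  have hf00 : ∀ᵐ v, v ∉ range x → f v = 0 := by
    refine ae_eq_zero_of_setIntegral_eq hf hf0 hrange ?_
    rw [hf1, integral_eq_lintegral_of_nonneg_ae (ae_of_all _ hf0) hf.1.restrict, ← image_univ,
      lintegral_image_of_monotone_lipschitz hx hK MeasurableSet.univ, setLIntegral_univ,
      lintegral_deriv_mul_comp_of_coupling hl hm hs hf hf0 hf1 hg hg0 hg1 hx hy hz hFG]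
    simp
  set B : ℝ → ℝ := fun z => eta * rho z + (5 + 4 / eta) / lam * (h z - rho z) with hB
  have hBi : Integrable B := (hri.const_mul _).add ((hh.sub hri).const_mul _)
  have hB1 : ∫ z, B z = eta + (5 + 4 / eta) / lam * ((∫ z, h z) - 1) := by
    have h1 : Integrable fun z => (5 + 4 / eta) / lam * (h z - rho z) := (hh.sub hri).const_mul _
    rw [integral_add (hri.const_mul _) h1, integral_const_mul, integral_const_mul,
      integral_sub hh hri, hr1, mul_one]
  have hB0 : ∀ᵐ z, 0 ≤ B z := by
    filter_upwards [hrh] with z hz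
    have := hr0 z
    have := sub_nonneg.2 hz
    positivity
  have hpos : ∫⁻ v, ENNReal.ofReal (f v - k v) ≤ ∫⁻ z, ENNReal.ofReal (B z) := by
    calc ∫⁻ v, ENNReal.ofReal (f v - k v)
        = ∫⁻ v in x '' univ, ENNReal.ofReal (f v - k v) := by
          rw [image_univ, ← lintegral_indicator hrange]
          refine lintegral_congr_ae ?_
          filter_upwards [hf00] with v hv
          by_cases hvr : v ∈ range x
          · rw [indicator_of_mem hvr]
          · rw [indicator_of_notMem hvr, hv hvr]
            exact ENNReal.ofReal_of_nonpos (by simpa using hh0 _)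
      _ = ∫⁻ z, ENNReal.ofReal (deriv x z) * ENNReal.ofReal (f (x z) - k (x z)) := by
          rw [lintegral_image_of_monotone_lipschitz hx hK MeasurableSet.univ, setLIntegral_univ]
      _ ≤ ∫⁻ z, (ENNReal.ofReal (rho z * (1 - deriv x z))
            + ENNReal.ofReal (deriv x z) * ENNReal.ofReal (h z - k (x z))) := by
          refine lintegral_mono_ae ?_
          filter_upwards [hrh] with z hz
          have hd : 0 ≤ deriv x z := hx.deriv_nonneg
          rw [← ENNReal.ofReal_mul hd, ← ENNReal.ofReal_mul hd]
          refine le_trans (ENNReal.ofReal_le_ofReal ?_) ENNReal.ofReal_add_le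
          have := mul_le_mul_of_nonneg_left hz hd
          have e : deriv x z * f (x z) = rho z := rfl
          linarith
      _ = (∫⁻ z, ENNReal.ofReal (rho z * (1 - deriv x z)))
            + ∫⁻ z, ENNReal.ofReal (deriv x z) * ENNReal.ofReal (h z - k (x z)) :=
          lintegral_add_left (hrm.mul (measurable_const.sub hdm)).ennreal_ofReal _
      _ ≤ (∫⁻ z, ENNReal.ofReal (rho z * (1 - deriv x z)))
            + ∫⁻ z, ENNReal.ofReal (deriv x z - 1) * ENNReal.ofReal (h z) :=
          add_le_add_right (lintegral_displacement_about_le hx hK hhm hh0 m hm1 hm2) _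
      _ = ∫⁻ z, (ENNReal.ofReal (rho z * (1 - deriv x z))
            + ENNReal.ofReal (deriv x z - 1) * ENNReal.ofReal (h z)) :=
          (lintegral_add_left (hrm.mul (measurable_const.sub hdm)).ennreal_ofReal _).symm
      _ ≤ ∫⁻ z, ENNReal.ofReal (B z) := by
          refine lintegral_mono_ae ?_
          filter_upwards [hpt] with z hz
          refine le_trans (le_of_eq ?_) (ENNReal.ofReal_le_ofReal
            (mul_posPart_add_mul_posPart_le hl heta hz.1 (hr0 z) hz.2.1 hz.2.2))
          rw [ENNReal.ofReal_add (mul_nonneg (hr0 z) (le_max_right _ _))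
            (mul_nonneg (hh0 z) (le_max_right _ _)), ENNReal.ofReal_mul (hr0 z),
            ENNReal.ofReal_mul (hr0 z), ENNReal.ofReal_mul (hh0 z), ENNReal.ofReal_max,
            ENNReal.ofReal_max, ENNReal.ofReal_zero, max_eq_left (zero_le (a := ENNReal.ofReal (1 - deriv x z))),
            max_eq_left (zero_le (a := ENNReal.ofReal (deriv x z - 1))),
            mul_comm (ENNReal.ofReal (h z))]
  have hpi : Integrable fun v => max (f v - k v) 0 := (hf.sub hki).pos_part
  have hposR : ∫ v, max (f v - k v) 0 ≤ ∫ z, B z := by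
    rw [integral_eq_lintegral_of_nonneg_ae hB0 hBi.1,
      integral_eq_lintegral_of_nonneg_ae (f := fun v => max (f v - k v) 0)
        (ae_of_all _ fun v => le_max_right _ _) hpi.1]
    refine ENNReal.toReal_mono ?_ ?_
    · rw [← ofReal_integral_eq_lintegral_ofReal hBi hB0]
      exact ENNReal.ofReal_ne_top
    · simpa [ENNReal.ofReal_max] using hpos
  calc ∫ v, |f v - k v| = ∫ v, (k v - f v + 2 * max (f v - k v) 0) := by
        refine integral_congr_ae (ae_of_all _ fun v => ?_)
        simp only
        rcases le_total (f v) (k v) with h | h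
        · rw [max_eq_right (by linarith), abs_of_nonpos (by linarith)]; ring
        · rw [max_eq_left (by linarith), abs_of_nonneg (by linarith)]; ring
    _ = (∫ z, h z) - 1 + 2 * ∫ v, max (f v - k v) 0 := by
        have h1 : Integrable fun v => k v - f v := hki.sub hf
        rw [integral_add h1 (hpi.const_mul _), integral_sub hki hf, integral_const_mul,
          hk1, hf1]
    _ ≤ _ := by rw [← hB1]; linarith

end Coupling

/-! ### Log-concave functions are measurable and unimodal. -/

section LogConcave

open Set

variable {φ : ℝ → ℝ}

theorem LogConcave.min_le (hφ : LogConcave φ) {x y z : ℝ} (hxy : x ≤ y) (hyz : y ≤ z) :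
    min (φ x) (φ z) ≤ φ y := by
  rcases hxy.eq_or_lt with rfl | hxy
  · exact min_le_left _ _
  rcases hyz.eq_or_lt with rfl | hyz
  · exact min_le_right _ _
  set s := (z - y) / (z - x) with hs
  have hzx : 0 < z - x := by linarith
  have hs0 : 0 < s := div_pos (by linarith) hzx
  have hs1 : s < 1 := (div_lt_one hzx).2 (by linarith)
  have hy : s * x + (1 - s) * z = y := by rw [hs]; field_simp; ring
  have h := hφ.2 x z s hs0 hs1
  rw [hy] at h
  refine le_trans ?_ h
  have hm : 0 ≤ min (φ x) (φ z) := le_min (hφ.1 _) (hφ.1 _)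
  have hs1' : 0 < 1 - s := by linarith
  calc min (φ x) (φ z) = min (φ x) (φ z) ^ s * min (φ x) (φ z) ^ (1 - s) := by
        rw [← Real.rpow_add_of_nonneg hm hs0.le hs1'.le]; simp
    _ ≤ φ x ^ s * φ z ^ (1 - s) :=
        mul_le_mul (Real.rpow_le_rpow hm (min_le_left _ _) hs0.le)
          (Real.rpow_le_rpow hm (min_le_right _ _) hs1'.le) (by positivity)
          (Real.rpow_nonneg (hφ.1 _) _)

theorem LogConcave.measurable (hφ : LogConcave φ) : Measurable φ := by
  refine measurable_of_Ioi fun t => Set.OrdConnected.measurableSet ⟨fun x hx z hz y hy => ?_⟩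
  exact (lt_min hx hz).trans_le (hφ.min_le hy.1 hy.2)

theorem not_monotone_of_integral_pos (hφ : Integrable φ) (h0 : ∀ x, 0 ≤ φ x) (h1 : 0 < ∫ x, φ x) :
    ¬ Monotone φ := by
  intro hm
  refine h1.ne' ?_
  have : φ = fun _ => 0 := by
    ext x
    by_contra hx
    have hpos : 0 < φ x := (h0 x).lt_of_ne (Ne.symm hx)
    have hc : IntegrableOn (fun _ => φ x) (Ioi x) := by
      refine Integrable.mono' (hφ.integrableOn (s := Ioi x)) aestronglyMeasurable_const ?_
      refine (ae_restrict_iff' measurableSet_Ioi).2 (ae_of_all _ fun y hy => ?_)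
      rw [Real.norm_of_nonneg hpos.le]
      exact hm (le_of_lt hy)
    rw [integrableOn_const_iff] at hc
    rcases hc with h | h
    · exact hx (enorm_eq_zero.1 h)
    · simp at h
  simp [this]

/-- The mode is the supremum of the points from which `φ` still rises strictly. Integrability with
positive integral excludes monotone functions, so this set is nonempty and bounded above. -/
theorem LogConcave.exists_mode (hφ : LogConcave φ) (hi : Integrable φ) (h1 : 0 < ∫ x, φ x) :
    ∃ m, MonotoneOn φ (Iio m) ∧ AntitoneOn φ (Ioi m) := by
  set E : Set ℝ := {x | ∃ y, x < y ∧ φ x < φ y} with hE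
  have hmono : ∀ x y z, x ≤ y → y < z → z ∈ E → φ x ≤ φ y := by
    rintro x y z hxy hyz ⟨w, hzw, hw⟩
    by_contra! h
    have h2 := hφ.min_le hxy (hyz.trans hzw).le
    have h3 := hφ.min_le hyz.le hzw.le
    rcases min_le_iff.1 h2 with h2 | h2
    · linarith
    · rcases min_le_iff.1 h3 with h3 | h3 <;> linarith
  have hne : E.Nonempty := by
    by_contra hemp
    rw [not_nonempty_iff_eq_empty] at hemp
    have hanti : Antitone φ := by
      intro x y hxy
      rcases hxy.eq_or_lt with rfl | hlt
      · exact le_rfl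
      · by_contra! h
        exact (hemp ▸ (show x ∈ E from ⟨y, hlt, h⟩) : x ∈ (∅ : Set ℝ))
    refine not_monotone_of_integral_pos hi.comp_neg (fun x => hφ.1 _)
      (by rwa [integral_neg_eq_self φ]) fun x y hxy => hanti (neg_le_neg hxy)
  have hbdd : BddAbove E := by
    by_contra hb
    refine not_monotone_of_integral_pos hi hφ.1 h1 fun x y hxy => ?_
    obtain ⟨z, hz, hyz⟩ := not_bddAbove_iff.1 hb y
    exact hmono x y z hxy hyz hz
  refine ⟨sSup E, fun x _ y hy hxy => ?_, fun x hx y _ hxy => ?_⟩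
  · obtain ⟨z, hz, hyz⟩ := exists_lt_of_lt_csSup hne hy
    exact hmono x y z hxy hyz hz
  · rcases hxy.eq_or_lt with rfl | hlt
    · exact le_rfl
    · by_contra! h
      exact absurd (le_csSup hbdd (show x ∈ E from ⟨y, hlt, h⟩)) (not_le.2 hx)

end LogConcave

/-! ### The sup-convolution. -/

section SupConv

variable {lam : ℝ} {f g h : ℝ → ℝ}

/-- Domination by `h` bounds the set above, so `sSup` is a true supremum and not the default 0. -/
theorem PLCondition.le_supConv (hPL : PLCondition lam h f g) : PLCondition lam (supConv lam f g) f g :=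
  fun x y => le_csSup ⟨h (lam * x + (1 - lam) * y), by
    rintro r ⟨x', y', hz, rfl⟩
    rw [hz]
    exact hPL x' y'⟩ ⟨x, y, rfl, rfl⟩

theorem PLCondition.supConv_le (hPL : PLCondition lam h f g) (z : ℝ) : supConv lam f g z ≤ h z := by
  refine csSup_le ⟨_, z, z, by ring, rfl⟩ ?_
  rintro r ⟨x, y, rfl, rfl⟩
  exact hPL x y

theorem supConv_nonneg (hf : ∀ x, 0 ≤ f x) (hg : ∀ x, 0 ≤ g x) (z : ℝ) : 0 ≤ supConv lam f g z := by
  refine Real.sSup_nonneg ?_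
  rintro r ⟨x, y, _, rfl⟩
  exact mul_nonneg (Real.rpow_nonneg (hf _) _) (Real.rpow_nonneg (hg _) _)

theorem csSup_rpow_mul_le {S : Set ℝ} (hS : S.Nonempty) (hS0 : ∀ r ∈ S, 0 ≤ r) {s c M : ℝ}
    (hs : 0 < s) (hc : 0 ≤ c) (hM : 0 ≤ M) (h : ∀ r ∈ S, r ^ s * c ≤ M) : sSup S ^ s * c ≤ M := by
  rcases hc.eq_or_lt with rfl | hc
  · simpa using hM
  have h1 : sSup S ≤ (M / c) ^ s⁻¹ := csSup_le hS fun r hr =>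
    (Real.le_rpow_inv_iff_of_pos (hS0 r hr) (by positivity) hs).2 ((le_div_iff₀ hc).2 (h r hr))
  rw [← le_div_iff₀ hc]
  exact (Real.le_rpow_inv_iff_of_pos (Real.sSup_nonneg hS0) (by positivity) hs).1 h1

/-- Combine competitors for `z₁` and `z₂` convexly into one for the intermediate point, then pass to
the two suprema one at a time. -/
theorem PLCondition.logConcave_supConv (hl : 0 < lam) (hl1 : lam < 1) (hf : LogConcave f)
    (hg : LogConcave g) (hPL : PLCondition lam h f g) : LogConcave (supConv lam f g) := by
  have hm : 0 < 1 - lam := by linarith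
  have hnn : ∀ x y, 0 ≤ f x ^ lam * g y ^ (1 - lam) := fun x y =>
    mul_nonneg (Real.rpow_nonneg (hf.1 _) _) (Real.rpow_nonneg (hg.1 _) _)
  have hsc := supConv_nonneg (lam := lam) hf.1 hg.1
  refine ⟨hsc, fun z₁ z₂ s hs hs1 => ?_⟩
  have hs' : 0 < 1 - s := by linarith
  refine csSup_rpow_mul_le ?_ ?_ hs (Real.rpow_nonneg (hsc _) _) (hsc _) ?_
  · exact ⟨_, z₁, z₁, by ring, rfl⟩
  · rintro r ⟨x, y, _, rfl⟩
    exact hnn x y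
  rintro r₁ ⟨x₁, y₁, hz₁, rfl⟩
  rw [mul_comm]
  refine csSup_rpow_mul_le ?_ ?_ hs' (Real.rpow_nonneg (hnn _ _) _) (hsc _) ?_
  · exact ⟨_, z₂, z₂, by ring, rfl⟩
  · rintro r ⟨x, y, _, rfl⟩
    exact hnn x y
  rintro r₂ ⟨x₂, y₂, hz₂, rfl⟩
  have hz : s * z₁ + (1 - s) * z₂
      = lam * (s * x₁ + (1 - s) * x₂) + (1 - lam) * (s * y₁ + (1 - s) * y₂) := by
    rw [hz₁, hz₂]; ring
  rw [hz]
  refine le_trans ?_ (hPL.le_supConv _ _)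
  have e : ∀ a b : ℝ, 0 ≤ a → 0 ≤ b → ∀ t : ℝ, (a ^ s * b ^ (1 - s)) ^ t
      = (a ^ t) ^ s * (b ^ t) ^ (1 - s) := by
    intro a b ha hb t
    rw [Real.mul_rpow (by positivity) (by positivity), ← Real.rpow_mul ha, ← Real.rpow_mul ha,
      ← Real.rpow_mul hb, ← Real.rpow_mul hb, mul_comm s, mul_comm (1 - s)]
  calc (f x₂ ^ lam * g y₂ ^ (1 - lam)) ^ (1 - s) * (f x₁ ^ lam * g y₁ ^ (1 - lam)) ^ s
      = (f x₁ ^ s * f x₂ ^ (1 - s)) ^ lam * (g y₁ ^ s * g y₂ ^ (1 - s)) ^ (1 - lam) := by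
        rw [e _ _ (hf.1 _) (hf.1 _), e _ _ (hg.1 _) (hg.1 _),
          Real.mul_rpow (Real.rpow_nonneg (hf.1 _) _) (Real.rpow_nonneg (hg.1 _) _),
          Real.mul_rpow (Real.rpow_nonneg (hf.1 _) _) (Real.rpow_nonneg (hg.1 _) _)]
        ring
    _ ≤ _ := by
        have h1 := hf.2 x₁ x₂ s hs hs1
        have h2 := hg.2 y₁ y₂ s hs hs1
        have h3 : 0 ≤ f x₁ ^ s * f x₂ ^ (1 - s) :=
          mul_nonneg (Real.rpow_nonneg (hf.1 _) _) (Real.rpow_nonneg (hf.1 _) _)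
        have h4 : 0 ≤ g y₁ ^ s * g y₂ ^ (1 - s) :=
          mul_nonneg (Real.rpow_nonneg (hg.1 _) _) (Real.rpow_nonneg (hg.1 _) _)
        exact mul_le_mul (Real.rpow_le_rpow h3 h1 hl.le) (Real.rpow_le_rpow h4 h2 hm.le)
          (Real.rpow_nonneg h4 _) (Real.rpow_nonneg (hf.1 _) _)

end SupConv

/-! ### Stability: probability densities, then scaling, then the three cases. -/

section Stability

open Set

variable {lam ε : ℝ} {f g h : ℝ → ℝ}

/-- Setting `f` to 0 on a null set makes it measurable and only lowers it, so a pointwise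
Prékopa–Leindler condition survives. -/
theorem exists_measurable_minorant (hf : Integrable f) (h0 : ∀ x, 0 ≤ f x) :
    ∃ f' : ℝ → ℝ, Measurable f' ∧ (∀ x, 0 ≤ f' x) ∧ (∀ x, f' x ≤ f x) ∧ f' =ᵐ[volume] f := by
  set N := toMeasurable volume {x | f x ≠ hf.1.mk f x} with hN
  have hN0 : volume N = 0 := by rw [hN, measure_toMeasurable]; exact hf.1.ae_eq_mk
  have hNm : MeasurableSet N := measurableSet_toMeasurable _ _
  have heq : ∀ x, x ∉ N → hf.1.mk f x = f x := fun x hx => by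
    by_contra h
    exact hx (subset_toMeasurable _ _ (Ne.symm h))
  have hval : ∀ x, Nᶜ.indicator (hf.1.mk f) x = Nᶜ.indicator f x := fun x => by
    by_cases hx : x ∈ Nᶜ
    · rw [indicator_of_mem hx, indicator_of_mem hx, heq x hx]
    · rw [indicator_of_notMem hx, indicator_of_notMem hx]
  refine ⟨Nᶜ.indicator (hf.1.mk f), hf.1.stronglyMeasurable_mk.measurable.indicator hNm.compl,
    fun x => ?_, fun x => ?_, ?_⟩
  · rw [hval]; exact indicator_nonneg (fun _ _ => h0 _) _
  · rw [hval]; exact indicator_le_self' (fun _ _ => h0 _) _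
  · filter_upwards [measure_eq_zero_iff_ae_notMem.1 hN0] with x hx
    rw [hval, indicator_of_mem (show x ∈ Nᶜ from hx)]

/-- Choose `eta = u = √(ε/t)`: the bound becomes `u + 2(u + 9u) = 21u`. For `ε = 0` let `eta` tend
to 0. -/
theorem le_sqrt_of_forall_deficit_bound {I D t : ℝ} (hl : 0 < lam) (ht : 0 < t) (htl : t ≤ lam)
    (hl1 : lam ≤ 1) (hD0 : 0 ≤ D) (hD : D ≤ ε) (hε : ε ≤ t)
    (h : ∀ eta : ℝ, 0 < eta → I ≤ D + 2 * (eta + (5 + 4 / eta) / lam * D)) :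
    I ≤ 21 * Real.sqrt (ε / t) := by
  rcases (hD0.trans hD).eq_or_lt with h0 | hpos
  · have hDz : D = 0 := le_antisymm (h0 ▸ hD) hD0
    subst hDz
    rw [← h0, zero_div, Real.sqrt_zero, mul_zero]
    refine le_of_forall_pos_le_add fun e he => ?_
    have := h (e / 2) (by positivity)
    linarith
  · set u := Real.sqrt (ε / t) with hu
    have hu0 : 0 < u := Real.sqrt_pos.2 (by positivity)
    have hu1 : u ≤ 1 := Real.sqrt_le_one.2 ((div_le_one ht).2 hε)
    have hu2 : ε = t * u ^ 2 := by rw [hu, Real.sq_sqrt (by positivity)]; field_simp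
    have h1 : D / lam ≤ u ^ 2 := by
      rw [div_le_iff₀ hl]
      nlinarith [mul_le_mul_of_nonneg_right htl (sq_nonneg u)]
    have h2 : (5 + 4 / u) / lam * D ≤ 9 * u := by
      calc (5 + 4 / u) / lam * D = (5 + 4 / u) * (D / lam) := by ring
        _ ≤ (5 + 4 / u) * u ^ 2 := mul_le_mul_of_nonneg_left h1 (by positivity)
        _ = 5 * u ^ 2 + 4 * u := by field_simp
        _ ≤ 9 * u := by nlinarith
    have h3 : D ≤ u := by
      have : D ≤ u ^ 2 := by nlinarith [sq_nonneg u]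
      nlinarith
    have := h u hu0
    linarith

theorem LogConcave.stability_of_probability (hl : 0 < lam) (hl1 : lam < 1) (hh : LogConcave h)
    (hhi : Integrable h) (hf : Integrable f) (hf0 : ∀ x, 0 ≤ f x) (hf1 : ∫ x, f x = 1)
    (hg : Integrable g) (hg0 : ∀ x, 0 ≤ g x) (hg1 : ∫ x, g x = 1) (hPL : PLCondition lam h f g) :
    1 ≤ ∫ x, h x ∧ ∀ ε, ε ≤ min lam (1 - lam) → ∫ x, h x ≤ 1 + ε → ∃ x₀ : ℝ,
      ∫ x, |f x - h (x + (1 - lam) * x₀)| ≤ 21 * Real.sqrt (ε / min lam (1 - lam)) ∧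
      ∫ x, |g x - h (x - lam * x₀)| ≤ 21 * Real.sqrt (ε / min lam (1 - lam)) := by
  have hm : 0 < 1 - lam := by linarith
  have ht : 0 < min lam (1 - lam) := lt_min hl hm
  obtain ⟨f', hf'm, hf'0, hf'le, hf'eq⟩ := exists_measurable_minorant hf hf0
  obtain ⟨g', hg'm, hg'0, hg'le, hg'eq⟩ := exists_measurable_minorant hg hg0
  have hf' : Integrable f' := hf.congr hf'eq.symm
  have hg' : Integrable g' := hg.congr hg'eq.symm
  have hf'1 : ∫ x, f' x = 1 := (integral_congr_ae hf'eq).trans hf1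
  have hg'1 : ∫ x, g' x = 1 := (integral_congr_ae hg'eq).trans hg1
  have hPL1 : ∀ v w, f' v ^ lam * g' w ^ (1 - lam) ≤ h (lam * v + (1 - lam) * w) := fun v w =>
    (mul_le_mul (Real.rpow_le_rpow (hf'0 _) (hf'le _) hl.le)
      (Real.rpow_le_rpow (hg'0 _) (hg'le _) hm.le) (Real.rpow_nonneg (hg'0 _) _)
      (Real.rpow_nonneg (hf0 _) _)).trans (hPL v w)
  have hPL2 : ∀ v w, g' v ^ (1 - lam) * f' w ^ lam ≤ h ((1 - lam) * v + lam * w) := fun v w => by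
    rw [mul_comm, add_comm]; exact hPL1 w v
  obtain ⟨x, y, hx, hy, hz, hFG⟩ := exists_monotone_coupling hl hm
    (monotone_integral_Iic hf' hf'0) (monotone_integral_Iic hg' hg'0)
    (continuous_integral_Iic hf') (continuous_integral_Iic hg')
    (tendsto_integral_Iic_zero Filter.tendsto_id) (hf'1 ▸ tendsto_integral_Iic_atTop hf')
    (tendsto_integral_Iic_zero Filter.tendsto_id) (hg'1 ▸ tendsto_integral_Iic_atTop hg')
  have hA := integral_abs_sub_translate_le_of_coupling hl hm (by ring) hf' hf'0 hf'1 hf'm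
    hg' hg'0 hg'1 hg'm hhi hh.1 hh.measurable hPL1 hx hy hz hFG
  have hB := integral_abs_sub_translate_le_of_coupling hm hl (by ring) hg' hg'0 hg'1 hg'm
    hf' hf'0 hf'1 hf'm hhi hh.1 hh.measurable hPL2 hy hx (fun z => by rw [add_comm, hz])
    (fun z => (hFG z).symm)
  refine ⟨hA.1, fun ε hε hhε => ?_⟩
  obtain ⟨m, hm1, hm2⟩ := hh.exists_mode hhi (by linarith [hA.1])
  have hzm := hz m
  -- Since `lam x m + (1 - lam) y m = m`, one number encodes both shifts: `m - x m = (1 - lam) x₀`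
  -- and `m - y m = -lam x₀`.
  refine ⟨y m - x m, ?_, ?_⟩
  · have e : ∫ v, |f v - h (v + (1 - lam) * (y m - x m))| = ∫ v, |f' v - h (v + (m - x m))| := by
      refine integral_congr_ae (hf'eq.mono fun v hv => ?_)
      simp only [hv]
      rw [show (1 - lam) * (y m - x m) = m - x m by linarith]
    rw [e]
    exact le_sqrt_of_forall_deficit_bound hl ht (min_le_left _ _) hl1.le (by linarith [hA.1])
      (by linarith) hε fun eta heta => hA.2 m eta hm1 hm2 heta
  · have e : ∫ v, |g v - h (v - lam * (y m - x m))| = ∫ v, |g' v - h (v + (m - y m))| := by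
      refine integral_congr_ae (hg'eq.mono fun v hv => ?_)
      simp only [hv]
      rw [show v - lam * (y m - x m) = v + (m - y m) by linarith]
    rw [e]
    exact le_sqrt_of_forall_deficit_bound hm ht (min_le_right _ _) (by linarith) (by linarith [hA.1])
      (by linarith) hε fun eta heta => hB.2 m eta hm1 hm2 heta

theorem LogConcave.const_mul {φ : ℝ → ℝ} (hφ : LogConcave φ) {c : ℝ} (hc : 0 < c) :
    LogConcave fun x => c * φ x := by
  refine ⟨fun x => mul_nonneg hc.le (hφ.1 x), fun x y s hs hs1 => ?_⟩
  rw [Real.mul_rpow hc.le (hφ.1 _), Real.mul_rpow hc.le (hφ.1 _)]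
  calc c ^ s * φ x ^ s * (c ^ (1 - s) * φ y ^ (1 - s))
      = c ^ s * c ^ (1 - s) * (φ x ^ s * φ y ^ (1 - s)) := by ring
    _ = c * (φ x ^ s * φ y ^ (1 - s)) := by rw [← Real.rpow_add hc]; simp
    _ ≤ _ := mul_le_mul_of_nonneg_left (hφ.2 x y s hs hs1) hc.le

theorem integral_abs_sub_eq_mul {f k : ℝ → ℝ} {A c d : ℝ} (hA : 0 < A) (hd : d = A * c) :
    ∫ x, |f x - d * k x| = A * ∫ x, |A⁻¹ * f x - c * k x| := by
  rw [← integral_const_mul]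
  refine integral_congr_ae (ae_of_all _ fun x => ?_)
  simp only
  have e : f x - d * k x = A * (A⁻¹ * f x - c * k x) := by
    rw [mul_sub, mul_inv_cancel_left₀ hA.ne', ← mul_assoc, hd]
  rw [e, abs_mul, abs_of_pos hA]

theorem LogConcave.stability (hl : 0 < lam) (hl1 : lam < 1) (hh : LogConcave h)
    (hhi : Integrable h) (hf : Integrable f) (hf0 : ∀ x, 0 ≤ f x) (hf1 : 0 < ∫ x, f x)
    (hg : Integrable g) (hg0 : ∀ x, 0 ≤ g x) (hg1 : 0 < ∫ x, g x) (hPL : PLCondition lam h f g) :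
    (∫ x, f x) ^ lam * (∫ x, g x) ^ (1 - lam) ≤ ∫ x, h x ∧ ∀ ε, ε ≤ min lam (1 - lam) →
      ∫ x, h x ≤ (1 + ε) * ((∫ x, f x) ^ lam * (∫ x, g x) ^ (1 - lam)) → ∃ a x₀ : ℝ, 0 < a ∧
      ∫ x, |f x - a ^ (-(1 - lam)) * h (x + (1 - lam) * x₀)|
        ≤ 21 * Real.sqrt (ε / min lam (1 - lam)) * ∫ x, f x ∧
      ∫ x, |g x - a ^ lam * h (x - lam * x₀)|
        ≤ 21 * Real.sqrt (ε / min lam (1 - lam)) * ∫ x, g x := by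
  have hm : 0 < 1 - lam := by linarith
  set A := ∫ x, f x with hA
  set B := ∫ x, g x with hB
  set M := A ^ lam * B ^ (1 - lam) with hM
  have hM0 : 0 < M := by positivity
  have key := (hh.const_mul (inv_pos.2 hM0)).stability_of_probability hl hl1 (hhi.const_mul _)
    (f := fun x => A⁻¹ * f x) (g := fun x => B⁻¹ * g x)
    (hf.const_mul _) (fun x => mul_nonneg (inv_pos.2 hf1).le (hf0 x))
    (by rw [integral_const_mul, inv_mul_cancel₀ hf1.ne'])
    (hg.const_mul _) (fun x => mul_nonneg (inv_pos.2 hg1).le (hg0 x))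
    (by rw [integral_const_mul, inv_mul_cancel₀ hg1.ne'])
    (fun x y => by
      rw [Real.mul_rpow (inv_pos.2 hf1).le (hf0 _), Real.mul_rpow (inv_pos.2 hg1).le (hg0 _),
        Real.inv_rpow hf1.le, Real.inv_rpow hg1.le, hM, mul_inv, mul_mul_mul_comm]
      exact mul_le_mul_of_nonneg_left (hPL x y) (by positivity))
  simp only [integral_const_mul] at key
  have hle : ∀ r, M⁻¹ * ∫ x, h x ≤ r ↔ ∫ x, h x ≤ r * M := fun r => by
    rw [inv_mul_le_iff₀ hM0, mul_comm]
  refine ⟨by have := key.1; rwa [le_inv_mul_iff₀ hM0, mul_one] at this, fun ε hε hhε => ?_⟩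
  obtain ⟨x₀, h1, h2⟩ := key.2 ε hε ((hle _).2 hhε)
  have hA1 : A ^ (1 - lam) * A ^ lam = A := by rw [← Real.rpow_add hf1]; simp
  have hB1 : B ^ (1 - lam) * B ^ lam = B := by rw [← Real.rpow_add hg1]; simp
  -- Undoing the normalization multiplies `h` by `A/M = (B/A)^(-(1-lam))` and `B/M = (B/A)^lam`.
  refine ⟨B / A, x₀, by positivity, ?_, ?_⟩
  · rw [integral_abs_sub_eq_mul (k := fun x => h (x + (1 - lam) * x₀)) (c := M⁻¹) hf1 ?_, mul_comm]
    · exact mul_le_mul_of_nonneg_right h1 hf1.le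
    · rw [Real.rpow_neg (by positivity), Real.div_rpow hg1.le hf1.le, hM]
      nth_rewrite 2 [← hA1]
      field_simp
  · rw [integral_abs_sub_eq_mul (k := fun x => h (x - lam * x₀)) (c := M⁻¹) hg1 ?_, mul_comm]
    · exact mul_le_mul_of_nonneg_right h2 hg1.le
    · rw [Real.div_rpow hg1.le hf1.le, hM]
      nth_rewrite 2 [← hB1]
      field_simp

theorem exists_logConcave_near (hl : 0 < lam) (hl1 : lam < 1) (hε : 0 ≤ ε)
    (hh0 : ∀ x, 0 ≤ h x) (hf0 : ∀ x, 0 ≤ f x) (hg0 : ∀ x, 0 ≤ g x) (hh : Integrable h)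
    (hf : Integrable f) (hg : Integrable g) (hf1 : 0 < ∫ x, f x) (hg1 : 0 < ∫ x, g x)
    (hPL : PLCondition lam h f g) (hlc : LogConcave h ∨ (LogConcave f ∧ LogConcave g))
    (hle : ∫ x, h x ≤ (1 + ε) * ((∫ x, f x) ^ lam * (∫ x, g x) ^ (1 - lam))) :
    ∃ (a x₀ : ℝ) (k : ℝ → ℝ), 0 < a ∧ LogConcave k ∧ Integrable k ∧
      ∫ x, |f x - a ^ (-(1 - lam)) * k (x + (1 - lam) * x₀)|
        ≤ 21 * (ε / min lam (1 - lam)) ^ (1 / 2 : ℝ) * ∫ x, f x ∧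
      ∫ x, |g x - a ^ lam * k (x - lam * x₀)|
        ≤ 21 * (ε / min lam (1 - lam)) ^ (1 / 2 : ℝ) * ∫ x, g x ∧
      ∫ x, |h x - k x| ≤ 21 * (ε / min lam (1 - lam)) ^ (1 / 2 : ℝ) * ∫ x, h x := by
  rw [← Real.sqrt_eq_rpow]
  have hm : 0 < 1 - lam := by linarith
  have ht : 0 < min lam (1 - lam) := lt_min hl hm
  set u := Real.sqrt (ε / min lam (1 - lam)) with hu
  have hu0 : 0 ≤ u := Real.sqrt_nonneg _
  have hH0 : 0 ≤ ∫ x, h x := integral_nonneg hh0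
  rcases le_total ε (min lam (1 - lam)) with hsmall | hlarge
  · have hεu : ε ≤ u := by
      have h1 : u ≤ 1 := Real.sqrt_le_one.2 ((div_le_one ht).2 hsmall)
      have h2 : u ^ 2 * min lam (1 - lam) = ε := by
        rw [hu, Real.sq_sqrt (by positivity)]; field_simp
      have h3 : min lam (1 - lam) ≤ 1 := (min_le_left _ _).trans hl1.le
      nlinarith [mul_le_mul_of_nonneg_left h3 (sq_nonneg u)]
    have main : ∀ k : ℝ → ℝ, LogConcave k → PLCondition lam k f g → (∀ x, k x ≤ h x) →
        ∃ (a x₀ : ℝ) (k : ℝ → ℝ), 0 < a ∧ LogConcave k ∧ Integrable k ∧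
          ∫ x, |f x - a ^ (-(1 - lam)) * k (x + (1 - lam) * x₀)| ≤ 21 * u * ∫ x, f x ∧
          ∫ x, |g x - a ^ lam * k (x - lam * x₀)| ≤ 21 * u * ∫ x, g x ∧
          ∫ x, |h x - k x| ≤ 21 * u * ∫ x, h x := by
      intro k hk hkPL hkh
      have hki : Integrable k := hh.mono' hk.measurable.aestronglyMeasurable
        (ae_of_all _ fun x => by rw [Real.norm_of_nonneg (hk.1 x)]; exact hkh x)
      obtain ⟨hkM, hst⟩ := hk.stability hl hl1 hki hf hf0 hf1 hg hg0 hg1 hkPL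
      have hkle : ∫ x, k x ≤ ∫ x, h x := integral_mono hki hh hkh
      obtain ⟨a, x₀, ha, h1, h2⟩ := hst ε hsmall (hkle.trans hle)
      refine ⟨a, x₀, k, ha, hk, hki, h1, h2, ?_⟩
      have e : ∫ x, |h x - k x| = (∫ x, h x) - ∫ x, k x := by
        rw [← integral_sub hh hki]
        exact integral_congr_ae (ae_of_all _ fun x => abs_of_nonneg (sub_nonneg.2 (hkh x)))
      rw [e]
      -- As `∫ k` is at least the Prékopa–Leindler bound `M`, `∫ h - ∫ k ≤ ε M ≤ ε ∫ h`, and `ε ≤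
      -- u`.
      nlinarith [mul_le_mul_of_nonneg_left (hkM.trans hkle) hε, mul_le_mul_of_nonneg_right hεu hH0]
    rcases hlc with hlc | ⟨hfl, hgl⟩
    · exact main h hlc hPL fun _ => le_rfl
    · exact main _ (hPL.logConcave_supConv hl hl1 hfl hgl) hPL.le_supConv hPL.supConv_le
  · have hu1 : 1 ≤ u := Real.one_le_sqrt.2 ((one_le_div ht).2 hlarge)
    have bound : ∀ p : ℝ → ℝ, (∀ x, 0 ≤ p x) → ∫ x, |p x| ≤ 21 * u * ∫ x, p x := by
      intro p hp
      rw [integral_congr_ae (ae_of_all _ fun x => abs_of_nonneg (hp x) : (fun x => |p x|) =ᵐ[_] p)]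
      have : 0 ≤ ∫ x, p x := integral_nonneg hp
      nlinarith
    -- For `ε ≥ τ` the allowed error exceeds the full mass, so zero will do.
    refine ⟨1, 0, fun _ => 0, one_pos, ⟨fun _ => le_rfl, fun x y s hs _ => ?_⟩, integrable_zero _ _ _,
      ?_, ?_, ?_⟩
    · rw [Real.zero_rpow hs.ne', zero_mul]
    · simpa using bound f hf0
    · simpa using bound g hg0
    · simpa using bound h hh0

end Stability

theorem theorem2 :
    -- stability, with an absolute constant `C`
    (∃ C : ℝ, 0 < C ∧
      ∀ lam ε : ℝ, 0 < lam → lam < 1 → 0 ≤ ε →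
      ∀ h f g : ℝ → ℝ,
        (∀ x, 0 ≤ h x) → (∀ x, 0 ≤ f x) → (∀ x, 0 ≤ g x) →
        Integrable h → Integrable f → Integrable g →
        0 < ∫ x, f x → 0 < ∫ x, g x →
        PLCondition lam h f g →
        (LogConcave h ∨ (LogConcave f ∧ LogConcave g)) →
        ∫ x, h x ≤ (1 + ε) * ((∫ x, f x) ^ lam * (∫ x, g x) ^ (1 - lam)) →
        ∃ (a x₀ : ℝ) (k : ℝ → ℝ), 0 < a ∧ LogConcave k ∧ Integrable k ∧
          ∫ x, |f x - a ^ (-(1 - lam)) * k (x + (1 - lam) * x₀)|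
            ≤ C * (ε / min lam (1 - lam)) ^ (1 / 2 : ℝ) * ∫ x, f x ∧
          ∫ x, |g x - a ^ lam * k (x - lam * x₀)|
            ≤ C * (ε / min lam (1 - lam)) ^ (1 / 2 : ℝ) * ∫ x, g x ∧
          ∫ x, |h x - k x|
            ≤ C * (ε / min lam (1 - lam)) ^ (1 / 2 : ℝ) * ∫ x, h x) ∧
    -- sharpness, with absolute constants `c` and `ε₀`
    (∃ c ε₀ : ℝ, 0 < c ∧ c < 1 ∧ 0 < ε₀ ∧
      ∀ lam ε : ℝ, 0 < lam → lam < 1 → 0 < ε → ε ≤ ε₀ * min lam (1 - lam) →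
      ∃ h f g : ℝ → ℝ,
        LogConcave f ∧ LogConcave g ∧
        Integrable h ∧ Integrable f ∧ Integrable g ∧
        ∫ x, f x = 1 ∧ ∫ x, g x = 1 ∧
        h = supConv lam f g ∧ PLCondition lam h f g ∧
        ∫ x, h x < 1 + ε ∧
        (∀ x₀ : ℝ,
          c * (ε / min lam (1 - lam)) ^ (1 / 2 : ℝ) ≤ ∫ x, |g x - f (x + x₀)|) ∧
        ∀ (a x₀ : ℝ) (k : ℝ → ℝ), 0 < a → LogConcave k → Integrable k →
          c * (ε / min lam (1 - lam)) ^ (1 / 2 : ℝ) * ∫ x, f x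
            ≤ ∫ x, |f x - a ^ (-(1 - lam)) * k (x + (1 - lam) * x₀)| ∨
          c * (ε / min lam (1 - lam)) ^ (1 / 2 : ℝ) * ∫ x, g x
            ≤ ∫ x, |g x - a ^ lam * k (x - lam * x₀)|)
 :=
  ⟨⟨21, by norm_num, fun _ _ hl hl1 hε _ _ _ hh0 hf0 hg0 hh hf hg hf1 hg1 hPL hlc hle =>
      exists_logConcave_near hl hl1 hε hh0 hf0 hg0 hh hf hg hf1 hg1 hPL hlc hle⟩,
    ⟨1 / 16, 1, by norm_num, by norm_num, one_pos, fun _ _ hl hl1 hε hε1 =>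
      exists_logConcave_far hl hl1 hε hε1⟩⟩
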